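/- Let $\mathcal T$ be a generalised triangulation: $n$ abstract tetrahedra, some or all of whose $4n$ triangular faces are affinely identified in pairs. Assume that no edge of $\mathcal T$ is identified with itself in reverse (this holds for every triangulation of a 3-manifold, in particular for every one-vertex triangulation of a knot complement). A normal surface in $\mathcal T$ is a properly embedded surface, considered up to normal isotopy, that meets each tetrahedron in a finite (possibly empty) collection of disjoint normal triangles and quadrilaterals; its vector $\mathbf v(S)\in\mathbb Z_{\ge 0}^{7n}$ counts the discs of each of the seven types (four triangle types and three quadrilateral types) in each tetrahedron. The matching cone is the set of all $\mathbf x\in\mathbb R^{7n}$ with $\mathbf x\ge 0$ that satisfy the matching equations: for any two glued faces and each corner of the common face, the numbers of normal arcs cutting off this corner, counted from the two sides, agree. Let $S$ be a normal surface in $\mathcal T$ with positive Euler characteristic, and suppose there is no normal surface $S'$ in $\mathcal T$ with positive Euler characteristic such that (i) whenever the $i$th coordinate of $\mathbf v(S)$ is zero, the $i$th coordinate of $\mathbf v(S')$ is zero; and (ii) there is some $i$ for which the $i$th coordinate of $\mathbf v(S)$ is non-zero but the $i$th coordinate of $\mathbf v(S')$ is zero. Then there is a smallest positive rational multiple $\mathbf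 u$ of $\mathbf v(S)$ whose coordinates are all integers. Some normal surface $U$ in $\mathcal T$ has $\mathbf v(U)=\mathbf u$, and every such $U$ is connected and has positive Euler characteristic. Moreover, $\mathbf v(S)$ is non-zero and lies on an extreme ray of the matching cone. -/

import Mathlib

/-- A generalised triangulation with `n` tetrahedra, each with vertices `0, 1, 2, 3`; face `f` of a
tetrahedron is the one opposite its vertex `f`. `glue t f = none` says that face `f` of tetrahedron
`t` is a boundary face. `glue t f = some (t', π)` says that it is affinely identified with face
`π f` of tetrahedron `t'`, each vertex `v ≠ f` of the face being sent to the vertex `π v`.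
Faces are glued in pairs of distinct faces. -/
structure Triangulation (n : ℕ) where
  glue : Fin n → Fin 4 → Option (Fin n × Equiv.Perm (Fin 4))
  glue_symm : ∀ t f t' π, glue t f = some (t', π) → glue t' (π f) = some (t, π⁻¹)
  glue_ne : ∀ t f t' π, glue t f = some (t', π) → (t', π f) ≠ (t, f)

namespace Triangulation

variable {n : ℕ}

/-- The elementary point identifications: points of tetrahedra are given in barycentric
coordinates, and a point of a glued face is identified with its image under the affine gluing. -/
def Glued (T : Triangulation n) (x y : Fin n × stdSimplex ℝ (Fin 4)) : Prop :=
  ∃ f π, T.glue x.1 f = some (y.1, π) ∧ x.2.1 f = 0 ∧ ∀ i, y.2.1 (π i) = x.2.1 i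

/-- The underlying space of the triangulation: the disjoint union of the `n` tetrahedra modulo the
equivalence relation generated by the gluings. -/
def Space (T : Triangulation n) : Type := Quot T.Glued

/-- The image in the underlying space of (the part in the tetrahedron of) a set `A`, placed in
tetrahedron `t`. -/
def image (T : Triangulation n) (t : Fin n) (A : Set (Fin 4 → ℝ)) : Set T.Space :=
  {q | ∃ p : stdSimplex ℝ (Fin 4), p.1 ∈ A ∧ Quot.mk T.Glued (t, p) = q}

/-- The elementary identifications of directed edges of tetrahedra, `(t, i, j)` being the edge of
tetrahedron `t` directed from vertex `i` to vertex `j`. -/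
def EdgeGlued (T : Triangulation n) (a b : Fin n × Fin 4 × Fin 4) : Prop :=
  ∃ f π, T.glue a.1 f = some (b.1, π) ∧ a.2.1 ≠ f ∧ a.2.2 ≠ f ∧ b.2.1 = π a.2.1 ∧ b.2.2 = π a.2.2

/-- No edge is identified with itself in reverse. Every triangulation of a 3-manifold has this
property: otherwise the midpoint of the edge has a neighbourhood which is a cone over a projective
plane. -/
def NoReversedEdge (T : Triangulation n) : Prop :=
  ∀ t i j, i ≠ j → ¬ Relation.EqvGen T.EdgeGlued (t, i, j) (t, j, i)

end Triangulation

/-- The seven types of normal discs in a tetrahedron: `tri v` truncates the vertex `v`, and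
`quad k` separates the vertices `0, k + 1` from the other two. -/
inductive DiscType : Type
  | tri (v : Fin 4)
  | quad (k : Fin 3)
  deriving DecidableEq

namespace DiscType

/-- The vertices of the tetrahedron on one side of a disc of the given type. -/
def side : DiscType → Finset (Fin 4)
  | tri v => {v}
  | quad k => {0, k.succ}

/-- A disc of type `τ` meets face `f` in an arc that cuts off the vertex `v` of `f` from the other
two vertices of `f`. -/
def CutsOff (τ : DiscType) (f v : Fin 4) : Prop :=
  v ≠ f ∧ ∀ w, w ≠ f → w ≠ v → (w ∈ τ.side ↔ v ∉ τ.side)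

instance (τ : DiscType) (f v : Fin 4) : Decidable (τ.CutsOff f v) := by
  unfold CutsOff; infer_instance

/-- The list of all seven types. -/
def all : Finset DiscType :=
  Finset.univ.image tri ∪ Finset.univ.image quad

end DiscType

/-- A normal disc in a tetrahedron, given by its type and its corners: it meets precisely the edges
`ij` with `i` on one side and `j` on the other, each in a single interior point, namely
`(1 - x) i + x j` with `x = pos i j`. So there are three corners for a triangle, four for a
quadrilateral. The disc meets the faces of the tetrahedron in straight arcs that join these
corners. A properly embedded disc in a tetrahedron is determined by its boundary curve up to an
isotopy that fixes the boundary of the tetrahedron, so only the corners are recorded. -/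
structure NormalDisc where
  type : DiscType
  pos : {i // i ∈ type.side} → {j // j ∉ type.side} → Set.Ioo (0 : ℝ) 1

namespace NormalDisc

/-- The corner of the disc on the edge `ij`, in barycentric coordinates. -/
noncomputable def corner (D : NormalDisc) (i : {i // i ∈ D.type.side})
    (j : {j // j ∉ D.type.side}) : Fin 4 → ℝ :=
  (1 - (D.pos i j : ℝ)) • Pi.single i.1 1 + (D.pos i j : ℝ) • Pi.single j.1 1

/-- The set of corners of the disc. -/
def corners (D : NormalDisc) : Set (Fin 4 → ℝ) := {p | ∃ i j, p = D.corner i j}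

/-- The intersection of the disc with face `f`: the segment between the two corners of the disc
on `f`, and empty if the disc misses `f`. -/
def arc (D : NormalDisc) (f : Fin 4) : Set (Fin 4 → ℝ) :=
  convexHull ℝ {p | p ∈ D.corners ∧ p f = 0}

/-- The boundary curve of the disc. -/
def boundary (D : NormalDisc) : Set (Fin 4 → ℝ) := ⋃ f, D.arc f

end NormalDisc

/-- A normal surface in `T`: a finite collection of normal discs in each tetrahedron. It is
embedded: distinct discs of a tetrahedron are disjoint (discs in a ball with pairwise disjoint
boundary curves can be taken to be pairwise disjoint, in only one way up to isotopy). It has no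
boundary in the interior of `T`: wherever a disc meets a glued face in an arc, there is a disc on
the other side of that face which continues it across the arc. -/
structure NormalSurface {n : ℕ} (T : Triangulation n) where
  discs : Fin n → Finset NormalDisc
  disjoint : ∀ t, ∀ D ∈ discs t, ∀ D' ∈ discs t, D ≠ D' → Disjoint D.boundary D'.boundary
  proper : ∀ t f t' π, T.glue t f = some (t', π) → ∀ D ∈ discs t, (D.arc f).Nonempty →
    ∃ D' ∈ discs t', D'.arc (π f) = (fun p i => p (π.symm i)) '' D.arc f

namespace NormalSurface

variable {n : ℕ} {T : Triangulation n}

/-- The vector representation `v(S)`, with `7n` coordinates: the number of discs of each type in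
each tetrahedron. -/
def vec (S : NormalSurface T) (t : Fin n) (τ : DiscType) : ℕ :=
  ((S.discs t).filter fun D => D.type = τ).card

/-- The vertices of the surface: the points where it meets the edges of `T`. -/
def vertices (S : NormalSurface T) : Set T.Space :=
  {q | ∃ t, ∃ D ∈ S.discs t, q ∈ T.image t D.corners}

/-- The edges of the surface: the arcs in which it meets the faces of `T`. -/
def arcs (S : NormalSurface T) : Set (Set T.Space) :=
  {a | ∃ t, ∃ D ∈ S.discs t, ∃ f, (D.arc f).Nonempty ∧ a = T.image t (D.arc f)}

/-- The Euler characteristic `V - E + F` of the surface, through its decomposition into normal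
discs. -/
noncomputable def eulerChar (S : NormalSurface T) : ℤ :=
  (S.vertices.ncard : ℤ) - (S.arcs.ncard : ℤ) + ∑ t, ((S.discs t).card : ℤ)

/-- Two discs of the surface, each given with its tetrahedron, have a point of the underlying
space in common. -/
def Meet (S : NormalSurface T) (a b : Σ t, {D // D ∈ S.discs t}) : Prop :=
  (T.image a.1 a.2.1.boundary ∩ T.image b.1 b.2.1.boundary).Nonempty

/-- The surface is connected: it is non-empty, and any two of its discs are joined by a finite
chain of discs in which consecutive ones meet. (The discs are compact, connected and finite in
number, so this is the connectedness of their union.) -/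
def Connected (S : NormalSurface T) : Prop :=
  Nonempty (Σ t, {D // D ∈ S.discs t}) ∧ ∀ a b, Relation.ReflTransGen S.Meet a b

end NormalSurface

/-- The matching cone: non-negative vectors in `ℝ^(7n)` that satisfy the matching equations. There
is one equation for each pair of glued faces and each vertex `v` of the face: the number of arcs
that cut off `v` is the same from both sides. -/
def Triangulation.matchingCone {n : ℕ} (T : Triangulation n) : Set (Fin n → DiscType → ℝ) :=
  {x | (∀ t τ, 0 ≤ x t τ) ∧ ∀ t f t' π, T.glue t f = some (t', π) → ∀ v, v ≠ f →
    ∑ τ ∈ DiscType.all.filter (fun τ => τ.CutsOff f v), x t τ =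
      ∑ τ ∈ DiscType.all.filter (fun τ => τ.CutsOff (π f) (π v)), x t' τ}

/-! The proof rests on two facts. First, the Euler characteristic is linear in the vector of a
normal surface (`NormalSurface.eulerChar_eq`): each vertex of the surface is shared evenly among the
corners of discs at that point, each arc among the one or two discs along it, and the number of
sharers depends only on the edge class or face class. For vertices this needs that no edge is
reversed, since otherwise one point of the surface could be two corners on the same edge of a
tetrahedron. Secondly, every natural number solution of the matching equations with at most one
quadrilateral type per tetrahedron is the vector of a surface
(`Triangulation.Matching.exists_surface`), obtained by spacing the intersections with each edge
equally. Conversely, surface vectors satisfy these conditions, and the quadrilateral condition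
passes to every vector supported in the support of a surface.

Let v be the vector of S. Clearing denominators, minimality says that the linear function `euler` is
not positive on rational points of the matching cone with support strictly inside that of v. If a
rational solution w in the support of v has `euler w = 0` and a negative coordinate, then moving
from v in the direction w reaches a point of the cone with strictly smaller support and the same
positive Euler characteristic, a contradiction. Applied to w and -w this gives w = 0. After
subtraction of a multiple of v, every rational solution in the support of v is therefore a multiple
of v (`NormalSurface.MinimalSupport.exists_eq_mul`).

Everything follows. Real solutions are treated by applying ℚ-linear functionals on ℝ, which gives
the extreme ray. If U has the smallest integral multiple of v as its vector, then the vector of any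
non-empty union of components of U is again a positive integral multiple of v, hence is all of the
vector of U, so U is connected. -/

/-! ### Points on the edges of a tetrahedron. -/

/-- The point `(1 - x) i + x j` of the edge `ij` of the tetrahedron. -/
noncomputable def edgePt (i j : Fin 4) (x : ℝ) : Fin 4 → ℝ :=
  (1 - x) • Pi.single i 1 + x • Pi.single j 1

theorem edgePt_swap (i j : Fin 4) (x : ℝ) : edgePt j i (1 - x) = edgePt i j x := by
  simp [edgePt, add_comm]

theorem edgePt_left {i j : Fin 4} (h : i ≠ j) (x : ℝ) : edgePt i j x i = 1 - x := by
  simp [edgePt, h]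

theorem edgePt_right {i j : Fin 4} (h : i ≠ j) (x : ℝ) : edgePt i j x j = x := by
  simp [edgePt, h.symm]

theorem edgePt_other {i j k : Fin 4} (hi : k ≠ i) (hj : k ≠ j) (x : ℝ) : edgePt i j x k = 0 := by
  simp [edgePt, hi, hj]

theorem edgePt_comp (π : Equiv.Perm (Fin 4)) (i j : Fin 4) (x : ℝ) :
    (fun k => edgePt i j x (π.symm k)) = edgePt (π i) (π j) x := by
  ext k
  simp [edgePt, Pi.single_apply, Equiv.symm_apply_eq]

theorem edgePt_mem_stdSimplex (i j : Fin 4) {x : ℝ} (h0 : 0 < x) (h1 : x < 1) :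
    edgePt i j x ∈ stdSimplex ℝ (Fin 4) := by
  refine (convex_stdSimplex ℝ (Fin 4)) (single_mem_stdSimplex ℝ i) (single_mem_stdSimplex ℝ j)
    ?_ ?_ ?_ <;> linarith

theorem ne_of_edgePt_eq_zero {i j f : Fin 4} (hij : i ≠ j) {x : ℝ} (h0 : 0 < x) (h1 : x < 1)
    (h : edgePt i j x f = 0) : f ≠ i ∧ f ≠ j := by
  constructor
  · rintro rfl
    rw [edgePt_left hij] at h
    linarith
  · rintro rfl
    rw [edgePt_right hij] at h
    linarith

theorem edgePt_inj {i j i' j' : Fin 4} (hij : i ≠ j) (hij' : i' ≠ j') {x y : ℝ} (h0 : 0 < x)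
    (h1 : x < 1) (h : edgePt i j x = edgePt i' j' y) :
    (i = i' ∧ j = j' ∧ x = y) ∨ (i = j' ∧ j = i' ∧ x = 1 - y) := by
  have key : ∀ k, k = i ∨ k = j → k = i' ∨ k = j' := by
    intro k hk
    by_contra hc
    push Not at hc
    have := ne_of_edgePt_eq_zero hij h0 h1 ((congrFun h k).trans (edgePt_other hc.1 hc.2 y))
    tauto
  have hl := congrFun h i
  rw [edgePt_left hij] at hl
  rcases key i (Or.inl rfl) with rfl | rfl
  · rcases key j (Or.inr rfl) with rfl | rfl
    · exact absurd rfl hij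
    · rw [edgePt_left hij] at hl
      exact Or.inl ⟨rfl, rfl, by linarith⟩
  · rcases key j (Or.inr rfl) with rfl | rfl
    · rw [edgePt_right hij'] at hl
      exact Or.inr ⟨rfl, rfl, by linarith⟩
    · exact absurd rfl hij

theorem exists_face_vertices : ∀ f v : Fin 4, v ≠ f → ∃ a b : Fin 4, a ≠ f ∧ b ≠ f ∧ a ≠ v ∧
    b ≠ v ∧ a ≠ b ∧ ∀ w, w = f ∨ w = v ∨ w = a ∨ w = b := by
  decide

/-! ### Combinatorics of the seven disc types. -/

namespace DiscType

/-- A disc of type `τ` separates the vertices `i` and `j`. -/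
def Sep (τ : DiscType) (i j : Fin 4) : Prop := i ∈ τ.side ↔ j ∉ τ.side

instance (τ : DiscType) (i j : Fin 4) : Decidable (τ.Sep i j) := by
  unfold Sep; infer_instance

theorem Sep.symm {τ : DiscType} {i j : Fin 4} (h : τ.Sep i j) : τ.Sep j i := by
  unfold Sep at *; tauto

theorem Sep.ne {τ : DiscType} {i j : Fin 4} (h : τ.Sep i j) : i ≠ j := by
  rintro rfl; unfold Sep at h; tauto

theorem mem_all (τ : DiscType) : τ ∈ all := by
  cases τ <;> simp [all]

instance : Fintype DiscType := ⟨all, mem_all⟩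

theorem CutsOff.sep {τ : DiscType} {f v w : Fin 4} (h : τ.CutsOff f v) (hw : w ≠ f)
    (hv : w ≠ v) : τ.Sep v w := by
  have := h.2 w hw hv
  unfold Sep; tauto

theorem cutsOff_of_sep {τ : DiscType} {f v a b : Fin 4} (hf : v ≠ f)
    (h : ∀ w, w = f ∨ w = v ∨ w = a ∨ w = b) (ha : τ.Sep v a) (hb : τ.Sep v b) :
    τ.CutsOff f v := by
  refine ⟨hf, fun w hw hv => ?_⟩
  rcases h w with rfl | rfl | rfl | rfl
  · exact absurd rfl hw
  · exact absurd rfl hv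
  · exact ha.symm
  · exact hb.symm

/-- Of the three vertices of the face, the third lies on the side of `i` or on that of `j`; the
other one of these two is cut off. -/
theorem exists_cutsOff {τ : DiscType} {f i j : Fin 4} (h : τ.Sep i j) (hi : i ≠ f) (hj : j ≠ f) :
    τ.CutsOff f i ∨ τ.CutsOff f j := by
  obtain ⟨a, b, haf, hbf, hai, hbi, hab, hall⟩ := exists_face_vertices f i hi
  obtain ⟨c, hcf, hci, hcj, hc⟩ : ∃ c, c ≠ f ∧ c ≠ i ∧ c ≠ j ∧ ∀ w, w = f ∨ w = i ∨ w = j ∨ w = c := by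
    rcases hall j with rfl | rfl | rfl | rfl
    · exact absurd rfl hj
    · exact absurd rfl h.ne
    · exact ⟨b, hbf, hbi, hab.symm, hall⟩
    · exact ⟨a, haf, hai, hab, fun w => by have := hall w; tauto⟩
  by_cases hs : τ.Sep i c
  · exact Or.inl (cutsOff_of_sep hi hc h hs)
  · refine Or.inr (cutsOff_of_sep (a := i) (b := c) hj (fun w => by have := hc w; tauto) h.symm ?_)
    unfold Sep at *; tauto

theorem CutsOff.eq {τ : DiscType} {f v w : Fin 4} (h : τ.CutsOff f v) (h' : τ.CutsOff f w) :
    v = w := by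
  by_contra hvw
  obtain ⟨a, b, haf, hbf, hav, hbv, hab, hall⟩ := exists_face_vertices f v h.1
  have h1 := h.sep h'.1 (Ne.symm hvw)
  have h2 := h.sep haf hav
  have h3 := h.sep hbf hbv
  rcases hall w with rfl | rfl | rfl | rfl
  · exact h'.1 rfl
  · exact hvw rfl
  · have h4 := h'.sep hbf hab.symm
    unfold Sep at *; tauto
  · have h4 := h'.sep haf hab
    unfold Sep at *; tauto

end DiscType

/-! ### Corners and arcs of a single disc. -/

namespace NormalDisc

/-- The position along the directed edge `ij` of the corner of the disc on this edge. -/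
noncomputable def param (D : NormalDisc) (i j : Fin 4) : ℝ :=
  if h : i ∈ D.type.side ∧ j ∉ D.type.side then D.pos ⟨i, h.1⟩ ⟨j, h.2⟩
  -- The final value 0 is a dummy for edges that the disc does not meet.
  else if h : j ∈ D.type.side ∧ i ∉ D.type.side then 1 - D.pos ⟨j, h.1⟩ ⟨i, h.2⟩ else 0

theorem param_of_mem (D : NormalDisc) {i j : Fin 4} (hi : i ∈ D.type.side)
    (hj : j ∉ D.type.side) : D.param i j = D.pos ⟨i, hi⟩ ⟨j, hj⟩ :=
  dif_pos ⟨hi, hj⟩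

theorem param_of_notMem (D : NormalDisc) {i j : Fin 4} (hi : i ∈ D.type.side)
    (hj : j ∉ D.type.side) : D.param j i = 1 - D.pos ⟨i, hi⟩ ⟨j, hj⟩ := by
  rw [param, dif_neg (fun h => hj h.1), dif_pos ⟨hi, hj⟩]

theorem sep_cases {τ : DiscType} {i j : Fin 4} (h : τ.Sep i j) :
    (i ∈ τ.side ∧ j ∉ τ.side) ∨ (j ∈ τ.side ∧ i ∉ τ.side) := by
  unfold DiscType.Sep at h; tauto

theorem param_swap (D : NormalDisc) {i j : Fin 4} (h : D.type.Sep i j) :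
    D.param j i = 1 - D.param i j := by
  rcases sep_cases h with ⟨hi, hj⟩ | ⟨hj, hi⟩
  · rw [D.param_of_mem hi hj, D.param_of_notMem hi hj]
  · rw [D.param_of_mem hj hi, D.param_of_notMem hj hi]; ring

theorem param_mem (D : NormalDisc) {i j : Fin 4} (h : D.type.Sep i j) :
    0 < D.param i j ∧ D.param i j < 1 := by
  rcases sep_cases h with ⟨hi, hj⟩ | ⟨hj, hi⟩
  · rw [D.param_of_mem hi hj]
    exact (D.pos ⟨i, hi⟩ ⟨j, hj⟩).2
  · rw [D.param_of_notMem hj hi]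
    have := (D.pos ⟨j, hj⟩ ⟨i, hi⟩).2
    constructor <;> linarith [this.1, this.2]

theorem edgePt_param_swap (D : NormalDisc) {i j : Fin 4} (h : D.type.Sep i j) :
    edgePt j i (D.param j i) = edgePt i j (D.param i j) := by
  rw [D.param_swap h, edgePt_swap]

theorem mem_corners {D : NormalDisc} {p : Fin 4 → ℝ} :
    p ∈ D.corners ↔ ∃ i j, D.type.Sep i j ∧ p = edgePt i j (D.param i j) := by
  constructor
  · rintro ⟨⟨i, hi⟩, ⟨j, hj⟩, rfl⟩
    refine ⟨i, j, by unfold DiscType.Sep; tauto, ?_⟩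
    rw [D.param_of_mem hi hj]
    rfl
  · rintro ⟨i, j, h, rfl⟩
    rcases sep_cases h with ⟨hi, hj⟩ | ⟨hj, hi⟩
    · refine ⟨⟨i, hi⟩, ⟨j, hj⟩, ?_⟩
      rw [D.param_of_mem hi hj]
      rfl
    · refine ⟨⟨j, hj⟩, ⟨i, hi⟩, ?_⟩
      rw [← D.edgePt_param_swap h, D.param_of_mem hj hi]
      rfl

theorem corners_face (D : NormalDisc) {f v a b : Fin 4} (h : D.type.CutsOff f v) (haf : a ≠ f)
    (hbf : b ≠ f) (hav : a ≠ v) (hbv : b ≠ v)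
    (hall : ∀ w, w = f ∨ w = v ∨ w = a ∨ w = b) :
    {p | p ∈ D.corners ∧ p f = 0} = {edgePt v a (D.param v a), edgePt v b (D.param v b)} := by
  have ha := h.sep haf hav
  have hb := h.sep hbf hbv
  ext p
  simp only [Set.mem_ofPred_eq, Set.mem_insert_iff, Set.mem_singleton_iff, mem_corners]
  constructor
  · rintro ⟨⟨i, j, hs, rfl⟩, hp⟩
    have hm := D.param_mem hs
    obtain ⟨hi, hj⟩ := ne_of_edgePt_eq_zero hs.ne hm.1 hm.2 hp
    rcases hall i with rfl | rfl | rfl | rfl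
    · exact absurd rfl hi
    · rcases hall j with rfl | rfl | rfl | rfl
      · exact absurd rfl hj
      · exact absurd rfl hs.ne
      · exact Or.inl rfl
      · exact Or.inr rfl
    · rcases hall j with rfl | rfl | rfl | rfl
      · exact absurd rfl hj
      · exact Or.inl (D.edgePt_param_swap ha)
      · exact absurd rfl hs.ne
      · unfold DiscType.Sep at *; tauto
    · rcases hall j with rfl | rfl | rfl | rfl
      · exact absurd rfl hj
      · exact Or.inr (D.edgePt_param_swap hb)
      · unfold DiscType.Sep at *; tauto
      · exact absurd rfl hs.ne
  · rintro (rfl | rfl)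
    · exact ⟨⟨v, a, ha, rfl⟩, edgePt_other h.1.symm haf.symm _⟩
    · exact ⟨⟨v, b, hb, rfl⟩, edgePt_other h.1.symm hbf.symm _⟩

theorem arc_eq_segment (D : NormalDisc) {f v a b : Fin 4} (h : D.type.CutsOff f v) (haf : a ≠ f)
    (hbf : b ≠ f) (hav : a ≠ v) (hbv : b ≠ v)
    (hall : ∀ w, w = f ∨ w = v ∨ w = a ∨ w = b) :
    D.arc f = segment ℝ (edgePt v a (D.param v a)) (edgePt v b (D.param v b)) := by
  rw [arc, D.corners_face h haf hbf hav hbv hall, convexHull_pair]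

theorem edgePt_mem_arc (D : NormalDisc) {f i j : Fin 4} (h : D.type.Sep i j) (hi : i ≠ f)
    (hj : j ≠ f) : edgePt i j (D.param i j) ∈ D.arc f :=
  subset_convexHull ℝ _ ⟨mem_corners.2 ⟨i, j, h, rfl⟩, edgePt_other hi.symm hj.symm _⟩

theorem arc_subset_boundary (D : NormalDisc) (f : Fin 4) : D.arc f ⊆ D.boundary :=
  Set.subset_iUnion D.arc f

theorem arc_nonempty_iff {D : NormalDisc} {f : Fin 4} :
    (D.arc f).Nonempty ↔ ∃ v, D.type.CutsOff f v := by
  rw [arc, convexHull_nonempty_iff]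
  constructor
  · rintro ⟨p, hp, h0⟩
    obtain ⟨i, j, hs, rfl⟩ := mem_corners.1 hp
    have hm := D.param_mem hs
    obtain ⟨hi, hj⟩ := ne_of_edgePt_eq_zero hs.ne hm.1 hm.2 h0
    rcases DiscType.exists_cutsOff hs hi.symm hj.symm with h | h
    exacts [⟨_, h⟩, ⟨_, h⟩]
  · rintro ⟨v, h⟩
    obtain ⟨a, b, haf, hbf, hav, hbv, hab, hall⟩ := exists_face_vertices f v h.1
    rw [D.corners_face h haf hbf hav hbv hall]
    exact ⟨_, Or.inl rfl⟩

/-- Coordinates on the arc of a disc in a face. -/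
theorem mem_arc_iff (D : NormalDisc) {f v a b : Fin 4} (h : D.type.CutsOff f v) (haf : a ≠ f)
    (hbf : b ≠ f) (hav : a ≠ v) (hbv : b ≠ v) (hab : a ≠ b)
    (hall : ∀ w, w = f ∨ w = v ∨ w = a ∨ w = b) (p : Fin 4 → ℝ) :
    p ∈ D.arc f ↔ ∃ s t : ℝ, 0 ≤ s ∧ 0 ≤ t ∧ s + t = 1 ∧ p f = 0 ∧
      p v = 1 - s * D.param v a - t * D.param v b ∧ p a = s * D.param v a ∧
      p b = t * D.param v b := by
  rw [D.arc_eq_segment h haf hbf hav hbv hall]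
  have hvf := h.1
  constructor
  · rintro ⟨s, t, hs, ht, hst, rfl⟩
    refine ⟨s, t, hs, ht, hst, ?_, ?_, ?_, ?_⟩ <;>
      simp [edgePt_other hvf.symm haf.symm, edgePt_other hvf.symm hbf.symm, edgePt_left hav.symm,
        edgePt_left hbv.symm, edgePt_right hav.symm, edgePt_right hbv.symm, edgePt_other hav hab,
        edgePt_other hbv hab.symm]
    linear_combination hst
  · rintro ⟨s, t, hs, ht, hst, h1, h2, h3, h4⟩
    refine ⟨s, t, hs, ht, hst, funext fun w => ?_⟩
    rcases hall w with rfl | rfl | rfl | rfl <;>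
      simp [edgePt_other hvf.symm haf.symm, edgePt_other hvf.symm hbf.symm, edgePt_left hav.symm,
        edgePt_left hbv.symm, edgePt_right hav.symm, edgePt_right hbv.symm, edgePt_other hav hab,
        edgePt_other hbv hab.symm, h1, h2, h3, h4]
    linear_combination hst

theorem arc_apply_self {D : NormalDisc} {f : Fin 4} {p : Fin 4 → ℝ} (hp : p ∈ D.arc f) :
    p f = 0 := by
  obtain ⟨v, h⟩ := arc_nonempty_iff.1 ⟨p, hp⟩
  obtain ⟨a, b, haf, hbf, hav, hbv, hab, hall⟩ := exists_face_vertices f v h.1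
  obtain ⟨s, t, hs, ht, hst, h0, -⟩ := (D.mem_arc_iff h haf hbf hav hbv hab hall p).1 hp
  exact h0

theorem arc_subset_stdSimplex (D : NormalDisc) (f : Fin 4) : D.arc f ⊆ stdSimplex ℝ (Fin 4) := by
  refine convexHull_min ?_ (convex_stdSimplex ℝ (Fin 4))
  rintro p ⟨hp, -⟩
  obtain ⟨i, j, hs, rfl⟩ := mem_corners.1 hp
  exact edgePt_mem_stdSimplex i j (D.param_mem hs).1 (D.param_mem hs).2

/-- An arc meets the edges of its face in corners only. -/
theorem mem_corners_of_mem_arc {D : NormalDisc} {f g : Fin 4} {p : Fin 4 → ℝ} (hp : p ∈ D.arc f)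
    (hg : g ≠ f) (h0 : p g = 0) : p ∈ D.corners := by
  obtain ⟨v, h⟩ := arc_nonempty_iff.1 ⟨p, hp⟩
  obtain ⟨a, b, haf, hbf, hav, hbv, hab, hall⟩ := exists_face_vertices f v h.1
  have ha := h.sep haf hav
  have hb := h.sep hbf hbv
  have ha' := D.param_mem ha
  have hb' := D.param_mem hb
  have hp' := hp
  rw [D.arc_eq_segment h haf hbf hav hbv hall] at hp'
  obtain ⟨s, t, hs, ht, hst, rfl⟩ := hp'
  rcases hs.eq_or_lt with rfl | hs
  · obtain rfl : t = 1 := by linarith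
    exact mem_corners.2 ⟨v, b, hb, by simp⟩
  rcases ht.eq_or_lt with rfl | ht
  · obtain rfl : s = 1 := by linarith
    exact mem_corners.2 ⟨v, a, ha, by simp⟩
  exfalso
  rcases hall g with rfl | rfl | rfl | rfl <;>
    simp [edgePt_left hav.symm, edgePt_left hbv.symm, edgePt_right hav.symm,
      edgePt_right hbv.symm, edgePt_other hav hab, edgePt_other hbv hab.symm] at h0
  · exact hg rfl
  · nlinarith [mul_pos hs (sub_pos.2 ha'.2), mul_pos ht (sub_pos.2 hb'.2)]
  · rcases h0 with h0 | h0 <;> linarith [ha'.1]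
  · rcases h0 with h0 | h0 <;> linarith [hb'.1]

theorem edgePt_mem_corners_iff {D : NormalDisc} {i j : Fin 4} (hij : i ≠ j) {x : ℝ} (h0 : 0 < x)
    (h1 : x < 1) : edgePt i j x ∈ D.corners ↔ D.type.Sep i j ∧ x = D.param i j := by
  constructor
  · intro h
    obtain ⟨k, l, hs, he⟩ := mem_corners.1 h
    have hm := D.param_mem hs
    rcases edgePt_inj hij hs.ne h0 h1 he with ⟨rfl, rfl, h⟩ | ⟨rfl, rfl, h⟩
    · exact ⟨hs, h⟩
    · exact ⟨hs.symm, by rw [h, D.param_swap hs]⟩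
  · rintro ⟨hs, rfl⟩
    exact mem_corners.2 ⟨i, j, hs, rfl⟩

theorem sep_of_edgePt_mem_arc {D : NormalDisc} {f i j : Fin 4} (hij : i ≠ j) {x : ℝ}
    (h0 : 0 < x) (h1 : x < 1) (h : edgePt i j x ∈ D.arc f) :
    D.type.Sep i j ∧ x = D.param i j := by
  rw [← edgePt_mem_corners_iff hij h0 h1]
  obtain ⟨hi, hj⟩ := ne_of_edgePt_eq_zero hij h0 h1 (arc_apply_self h)
  obtain ⟨a, b, haf, hbf, hai, hbi, hab, hall⟩ := exists_face_vertices f i hi.symm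
  by_cases haj : a = j
  · exact mem_corners_of_mem_arc h hbf (edgePt_other hbi (haj ▸ hab.symm) x)
  · exact mem_corners_of_mem_arc h haf (edgePt_other hai haj x)

/-- A disc that continues another one across a glued face has the corresponding corners on it. -/
theorem sep_of_arc_eq {D D' : NormalDisc} {f : Fin 4} {π : Equiv.Perm (Fin 4)}
    (h : D'.arc (π f) = (fun p i => p (π.symm i)) '' D.arc f) {i j : Fin 4}
    (hs : D.type.Sep i j) (hi : i ≠ f) (hj : j ≠ f) :
    D'.type.Sep (π i) (π j) ∧ D'.param (π i) (π j) = D.param i j := by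
  have hm := D.param_mem hs
  have : edgePt (π i) (π j) (D.param i j) ∈ D'.arc (π f) := by
    rw [h, ← edgePt_comp]
    exact ⟨_, D.edgePt_mem_arc hs hi hj, rfl⟩
  have := sep_of_edgePt_mem_arc (π.injective.ne hs.ne) hm.1 hm.2 this
  exact ⟨this.1, this.2.symm⟩

theorem cutsOff_of_arc_eq {D D' : NormalDisc} {f v : Fin 4} {π : Equiv.Perm (Fin 4)}
    (h : D'.arc (π f) = (fun p i => p (π.symm i)) '' D.arc f) (hv : D.type.CutsOff f v) :
    D'.type.CutsOff (π f) (π v) := by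
  refine ⟨π.injective.ne hv.1, fun w hw hwv => ?_⟩
  have hs := hv.sep (w := π.symm w) (fun e => hw (by rw [← e]; simp))
    (fun e => hwv (by rw [← e]; simp))
  have := (sep_of_arc_eq h hs hv.1 (fun e => hw (by rw [← e]; simp))).1
  rw [Equiv.apply_symm_apply] at this
  exact this.symm

/-- Relabelling coordinates is linear, so it carries segments to segments, and matching end points
suffice for matching arcs. -/
theorem arc_eq_of_param_eq {D D' : NormalDisc} {f v : Fin 4} {π : Equiv.Perm (Fin 4)}
    (hv : D.type.CutsOff f v) (hv' : D'.type.CutsOff (π f) (π v))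
    (h : ∀ w, w ≠ f → w ≠ v → D'.param (π v) (π w) = D.param v w) :
    D'.arc (π f) = (fun p i => p (π.symm i)) '' D.arc f := by
  obtain ⟨a, b, haf, hbf, hav, hbv, hab, hall⟩ := exists_face_vertices f v hv.1
  have hall' : ∀ w, w = π f ∨ w = π v ∨ w = π a ∨ w = π b := by
    intro w
    have := hall (π.symm w)
    simpa only [Equiv.symm_apply_eq] using this
  rw [D.arc_eq_segment hv haf hbf hav hbv hall, D'.arc_eq_segment hv' (π.injective.ne haf)
    (π.injective.ne hbf) (π.injective.ne hav) (π.injective.ne hbv) hall', h a haf hav, h b hbf hbv,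
    ← edgePt_comp, ← edgePt_comp]
  change _ = (LinearMap.funLeft ℝ ℝ π.symm).toAffineMap '' _
  rw [image_segment]
  rfl

end NormalDisc

/-! ### Crossing arcs in a face. -/

/-- Two arcs in a triangle that cut off different vertices meet if their end points on the common
edge are in the wrong order. -/
theorem arcs_cross {p q r s : ℝ} (hq : 0 < q) (hr : 0 < r) (hs : 0 < s) (hp1 : p < 1)
    (hr1 : r < 1) (hs1 : s < 1) (hqp : q ≤ p) :
    ∃ l m : ℝ, 0 ≤ l ∧ l ≤ 1 ∧ 0 ≤ m ∧ m ≤ 1 ∧ l * s = m * r ∧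
      (1 - l) * p = m * (1 - r) + (1 - m) * q := by
  -- This is the denominator in the solution of the two linear equations for `l` and `m`.
  have hd : 0 < r * p + s * (1 - r - q) := by
    rcases le_total s p with h | h
    · nlinarith [mul_nonneg hr.le (sub_nonneg.2 h), mul_pos hs (sub_pos.2 (hqp.trans_lt hp1))]
    · nlinarith [mul_nonneg (sub_nonneg.2 hr1.le) (sub_nonneg.2 h),
        mul_pos hq (sub_pos.2 hs1), mul_pos (hq.trans_le hqp) (sub_pos.2 hr1)]
  refine ⟨r * (p - q) / (r * p + s * (1 - r - q)), s * (p - q) / (r * p + s * (1 - r - q)),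
    div_nonneg (mul_nonneg hr.le (sub_nonneg.2 hqp)) hd.le, (div_le_one hd).2 ?_,
    div_nonneg (mul_nonneg hs.le (sub_nonneg.2 hqp)) hd.le, (div_le_one hd).2 ?_, ?_, ?_⟩
  · rcases le_total r s with h | h
    · nlinarith [mul_nonneg (sub_nonneg.2 h) (sub_nonneg.2 (hqp.trans hp1.le)),
        mul_pos hr (sub_pos.2 hs1)]
    · nlinarith [mul_nonneg (sub_nonneg.2 h) hq.le, mul_pos hs (sub_pos.2 hr1)]
  · rcases le_total s r with h | h
    · nlinarith [mul_nonneg (sub_nonneg.2 h) (hq.le.trans hqp), mul_pos hs (sub_pos.2 hr1)]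
    · nlinarith [mul_nonneg (sub_nonneg.2 h) (sub_nonneg.2 hp1.le), mul_pos hr (sub_pos.2 hs1)]
  · ring
  · field_simp
    ring

theorem exists_third_vertex {f v w : Fin 4} (hv : v ≠ f) (hw : w ≠ f) (hvw : v ≠ w) :
    ∃ a, a ≠ f ∧ a ≠ v ∧ a ≠ w ∧ ∀ x, x = f ∨ x = v ∨ x = a ∨ x = w := by
  obtain ⟨a, b, haf, hbf, hav, hbv, hab, hall⟩ := exists_face_vertices f v hv
  rcases hall w with rfl | rfl | rfl | rfl
  · exact absurd rfl hw
  · exact absurd rfl hvw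
  · exact ⟨b, hbf, hbv, hab.symm, fun x => by have := hall x; tauto⟩
  · exact ⟨a, haf, hav, hab, hall⟩

/-- Disjoint discs of which one cuts off `v` and the other one cuts off `w`, in the same face. -/
theorem NormalDisc.param_lt_of_disjoint {D D' : NormalDisc}
    (h : Disjoint D.boundary D'.boundary) {f v w : Fin 4} (hv : D.type.CutsOff f v)
    (hw : D'.type.CutsOff f w) (hvw : v ≠ w) : D.param v w < D'.param v w := by
  by_contra hle
  push Not at hle
  obtain ⟨a, haf, hav, haw, hall⟩ := exists_third_vertex hv.1 hw.1 hvw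
  have s1 := hv.sep haf hav
  have s2 := hv.sep hw.1 hvw.symm
  have s3 := hw.sep haf haw
  have s4 := hw.sep hv.1 hvw
  have m1 := D.param_mem s1
  have m2 := D.param_mem s2
  have m3 := D'.param_mem s3
  have m4 := D'.param_mem s4.symm
  obtain ⟨l, m, hl0, hl1, hm0, hm1, e1, e2⟩ := arcs_cross m4.1 m3.1 m1.1 m2.2 m3.2 m1.2 hle
  obtain ⟨x, hx⟩ : ∃ x : Fin 4 → ℝ, x = l • edgePt v a (D.param v a) +
    (1 - l) • edgePt v w (D.param v w) := ⟨_, rfl⟩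
  have hx1 : x ∈ D.arc f := by
    rw [D.arc_eq_segment hv haf hw.1 hav hvw.symm hall]
    exact ⟨l, 1 - l, hl0, by linarith, by ring, hx.symm⟩
  refine Set.disjoint_left.1 h (D.arc_subset_boundary f hx1) (D'.arc_subset_boundary f ?_)
  have hvf := hv.1
  have hwf := hw.1
  have h4 := D'.param_swap s4
  rw [D'.mem_arc_iff hw haf hv.1 haw hvw hav (fun x => by have := hall x; tauto)]
  refine ⟨m, 1 - m, hm0, by linarith, by ring, ?_, ?_, ?_, ?_⟩ <;> rw [hx] <;>
    simp [edgePt_other hvf.symm haf.symm, edgePt_other hvf.symm hwf.symm, edgePt_left hav.symm,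
        edgePt_left hvw, edgePt_right hav.symm, edgePt_right hvw, edgePt_other hav haw,
        edgePt_other hvw.symm haw.symm]
  · linear_combination e2 + (1 - m) * h4
  · linear_combination e1
  · linear_combination - e1 - e2 - (1 - m) * h4

theorem exists_face : ∀ i j : Fin 4, ∃ f, i ≠ f ∧ j ≠ f := by
  decide

/-! ### Matching equations and the quadrilateral condition for surfaces. -/

/-- The matching equations. -/
def Triangulation.Matching {n : ℕ} (T : Triangulation n) {R : Type*} [AddCommMonoid R]
    (x : Fin n → DiscType → R) : Prop :=
  ∀ t f t' π, T.glue t f = some (t', π) → ∀ v, v ≠ f →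
    ∑ τ ∈ DiscType.all.filter (fun τ => τ.CutsOff f v), x t τ =
      ∑ τ ∈ DiscType.all.filter (fun τ => τ.CutsOff (π f) (π v)), x t' τ

/-- Both types cross the edge `vw`, and in its two faces they cut off opposite ends. Disjoint discs
would thus have their corners on `vw` in two contradictory orders. -/
theorem DiscType.exists_quad_conflict : ∀ k k' : Fin 3, k ≠ k' → ∃ f g v w : Fin 4, v ≠ w ∧
    (quad k).CutsOff f v ∧ (quad k').CutsOff f w ∧
    (quad k).CutsOff g w ∧ (quad k').CutsOff g v := by
  decide

namespace NormalSurface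

variable {n : ℕ} {T : Triangulation n}

theorem eq_of_arc_inter (S : NormalSurface T) {t : Fin n} {D D' : NormalDisc}
    (hD : D ∈ S.discs t) (hD' : D' ∈ S.discs t) {f g : Fin 4} {p : Fin 4 → ℝ} (h : p ∈ D.arc f)
    (h' : p ∈ D'.arc g) : D = D' := by
  by_contra hne
  exact Set.disjoint_left.1 (S.disjoint t D hD D' hD' hne) (D.arc_subset_boundary f h)
    (D'.arc_subset_boundary g h')

theorem eq_of_param_eq (S : NormalSurface T) {t : Fin n} {D D' : NormalDisc}
    (hD : D ∈ S.discs t) (hD' : D' ∈ S.discs t) {i j : Fin 4} (h : D.type.Sep i j)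
    (h' : D'.type.Sep i j) (he : D.param i j = D'.param i j) : D = D' := by
  obtain ⟨f, hi, hj⟩ : ∃ f, i ≠ f ∧ j ≠ f := exists_face i j
  refine S.eq_of_arc_inter hD hD' (g := f) (D.edgePt_mem_arc h hi hj) ?_
  rw [he]
  exact D'.edgePt_mem_arc h' hi hj

theorem quad_eq (S : NormalSurface T) {t : Fin n} {k k' : Fin 3}
    (h : S.vec t (.quad k) ≠ 0) (h' : S.vec t (.quad k') ≠ 0) : k = k' := by
  by_contra hkk
  obtain ⟨D, hD⟩ := Finset.card_ne_zero.1 h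
  obtain ⟨D', hD'⟩ := Finset.card_ne_zero.1 h'
  rw [Finset.mem_filter] at hD hD'
  obtain ⟨f, g, v, w, hvw, h1, h2, h3, h4⟩ := DiscType.exists_quad_conflict k k' hkk
  have hne : D ≠ D' := by
    rintro rfl
    exact hkk (DiscType.quad.inj (hD.2.symm.trans hD'.2))
  have hd := S.disjoint t D hD.1 D' hD'.1 hne
  rw [← hD.2] at h1 h3
  rw [← hD'.2] at h2 h4
  exact lt_asymm (NormalDisc.param_lt_of_disjoint hd h1 h2 hvw)
    (NormalDisc.param_lt_of_disjoint hd.symm h4 h3 hvw)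

theorem sum_vec_filter (S : NormalSurface T) (t : Fin n) (P : DiscType → Prop)
    [DecidablePred P] :
    ∑ τ ∈ DiscType.all.filter P, S.vec t τ = ((S.discs t).filter fun D => P D.type).card := by
  rw [Finset.card_eq_sum_card_fiberwise (f := fun D => D.type) (t := DiscType.all.filter P)]
  · refine Finset.sum_congr rfl fun τ hτ => ?_
    rw [Finset.filter_filter]
    unfold vec
    congr 1
    refine Finset.filter_congr fun D _ => ?_
    have := (Finset.mem_filter.1 hτ).2
    exact ⟨fun h => ⟨h ▸ this, h⟩, fun h => h.2⟩
  · intro D hD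
    simpa [DiscType.mem_all] using (Finset.mem_filter.1 hD).2

/-- Continuing discs across the face is injective: two discs with the same continuation share an
arc, so they coincide by disjointness. -/
theorem card_cutsOff_le (S : NormalSurface T) {t f t' π} (h : T.glue t f = some (t', π))
    (v : Fin 4) :
    ((S.discs t).filter fun D => D.type.CutsOff f v).card ≤
      ((S.discs t').filter fun D => D.type.CutsOff (π f) (π v)).card := by
  have key : ∀ D ∈ (S.discs t).filter (fun D => D.type.CutsOff f v), ∃ D' ∈ S.discs t',
      D'.arc (π f) = (fun p i => p (π.symm i)) '' D.arc f := by
    intro D hD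
    rw [Finset.mem_filter] at hD
    exact S.proper t f t' π h D hD.1 (NormalDisc.arc_nonempty_iff.2 ⟨v, hD.2⟩)
  choose! F hF hF' using key
  refine Finset.card_le_card_of_injOn F (fun D hD => ?_) (fun D hD D' hD' he => ?_)
  · exact Finset.mem_filter.2 ⟨hF D hD, NormalDisc.cutsOff_of_arc_eq (hF' D hD)
      (Finset.mem_filter.1 hD).2⟩
  · have e := (hF' D hD).symm.trans ((congrArg (fun E => E.arc (π f)) he).trans (hF' D' hD'))
    have inj : Function.Injective (fun (p : Fin 4 → ℝ) i => p (π.symm i)) :=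
      fun p q hpq => funext fun i => by simpa using congrFun hpq (π i)
    rw [inj.image_injective.eq_iff] at e
    have hD := Finset.mem_filter.1 hD
    obtain ⟨p, hp⟩ := NormalDisc.arc_nonempty_iff.2 ⟨v, hD.2⟩
    exact S.eq_of_arc_inter hD.1 (Finset.mem_filter.1 hD').1 hp (e ▸ hp)

theorem matching_vec (S : NormalSurface T) : T.Matching S.vec := by
  intro t f t' π h v hv
  rw [S.sum_vec_filter, S.sum_vec_filter]
  refine le_antisymm (S.card_cutsOff_le h v) ?_
  have := S.card_cutsOff_le (T.glue_symm _ _ _ _ h) (π v)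
  simpa using this

end NormalSurface

/-! ### Point identifications, and counting the vertices and arcs of a surface. -/

open Classical in
/-- Counting an image, if the fibres are known up to a bijection. -/
theorem Finset.card_image_eq_sum_inv {α β γ : Type*} (s : Finset α) (g : α → β) (h : α → γ)
    (K : α → Finset γ) (hinj : ∀ a ∈ s, ∀ b ∈ s, g a = g b → h a = h b → a = b)
    (hK : ∀ a ∈ s, ∀ c, c ∈ K a ↔ ∃ b ∈ s, g b = g a ∧ h b = c) :
    ((s.image g).card : ℚ) = ∑ a ∈ s, ((K a).card : ℚ)⁻¹ := by
  have hcard : ∀ a ∈ s, (K a).card = (s.filter fun b => g b = g a).card := by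
    intro a ha
    have : K a = (s.filter fun b => g b = g a).image h := by
      ext c
      simp [hK a ha, and_assoc]
    rw [this, Finset.card_image_of_injOn]
    intro b hb c hc hbc
    have hb := Finset.mem_filter.1 hb
    have hc := Finset.mem_filter.1 hc
    exact hinj b hb.1 c hc.1 (hb.2.trans hc.2.symm) hbc
  rw [← Finset.sum_fiberwise_of_maps_to (fun a ha => Finset.mem_image_of_mem g ha),
    Finset.cast_card]
  refine Finset.sum_congr rfl fun y hy => ?_
  obtain ⟨a, ha, rfl⟩ := Finset.mem_image.1 hy
  have hne : (s.filter fun b => g b = g a).card ≠ 0 :=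
    Finset.card_ne_zero.2 ⟨a, Finset.mem_filter.2 ⟨ha, rfl⟩⟩
  rw [Finset.sum_congr rfl (g := fun _ => ((s.filter fun b => g b = g a).card : ℚ)⁻¹)]
  · rw [Finset.sum_const, nsmul_eq_mul, mul_inv_cancel₀ (by exact_mod_cast hne)]
  · intro b hb
    have hb := Finset.mem_filter.1 hb
    rw [hcard b hb.1, hb.2]

theorem Quot.mk_eq_iff_eqvGen {α : Type*} {r : α → α → Prop} {a b : α} :
    Quot.mk r a = Quot.mk r b ↔ Relation.EqvGen r a b :=
  ⟨Quot.eqvGen_exact, Quot.eqvGen_sound⟩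

namespace Triangulation

variable {n : ℕ} (T : Triangulation n)

theorem Glued.symm {T : Triangulation n} {x y : Fin n × stdSimplex ℝ (Fin 4)}
    (h : T.Glued x y) : T.Glued y x := by
  obtain ⟨f, π, hg, h0, h⟩ := h
  refine ⟨π f, π⁻¹, T.glue_symm _ _ _ _ hg, (h f).trans h0, fun i => ?_⟩
  rw [← h]
  exact congrArg _ (π.apply_symm_apply i)

theorem EdgeGlued.symm {T : Triangulation n} {a b : Fin n × Fin 4 × Fin 4}
    (h : T.EdgeGlued a b) : T.EdgeGlued b a := by
  obtain ⟨f, π, hg, h1, h2, h3, h4⟩ := h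
  refine ⟨π f, π⁻¹, T.glue_symm _ _ _ _ hg, ?_, ?_, ?_, ?_⟩
  · rw [h3]; exact π.injective.ne h1
  · rw [h4]; exact π.injective.ne h2
  · rw [h3]; exact (π.symm_apply_apply _).symm
  · rw [h4]; exact (π.symm_apply_apply _).symm

theorem EdgeGlued.swap {T : Triangulation n} {a b : Fin n × Fin 4 × Fin 4}
    (h : T.EdgeGlued a b) : T.EdgeGlued (a.1, a.2.2, a.2.1) (b.1, b.2.2, b.2.1) := by
  obtain ⟨f, π, hg, h1, h2, h3, h4⟩ := h
  exact ⟨f, π, hg, h2, h1, h4, h3⟩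

theorem eqvGen_edgeGlued_swap {T : Triangulation n} {a b : Fin n × Fin 4 × Fin 4}
    (h : Relation.EqvGen T.EdgeGlued a b) :
    Relation.EqvGen T.EdgeGlued (a.1, a.2.2, a.2.1) (b.1, b.2.2, b.2.1) := by
  induction h with
  | rel a b h => exact .rel _ _ h.swap
  | refl a => exact .refl _
  | symm a b _ ih => exact ih.symm
  | trans a b c _ _ ih1 ih2 => exact ih1.trans _ _ _ ih2

/-- Induction along chains of a symmetric relation. -/
theorem eqvGen_induction {α : Type*} {r : α → α → Prop} (hr : ∀ a b, r a b → r b a)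
    {P : α → Prop} (hP : ∀ a b, r a b → P a → P b) {a b : α} (h : Relation.EqvGen r a b)
    (ha : P a) : P b := by
  suffices P a ↔ P b from this.1 ha
  clear ha
  induction h with
  | rel a b h => exact ⟨hP a b h, hP b a (hr a b h)⟩
  | refl a => exact Iff.rfl
  | symm a b _ ih => exact ih.symm
  | trans a b c _ _ ih1 ih2 => exact ih1.trans ih2

/-- A point in the interior of an edge is identified with the corresponding points of the edges
identified with this one, and with no others. -/
theorem exists_edge_of_mk_eq {t t' : Fin n} {p p' : stdSimplex ℝ (Fin 4)} {i j : Fin 4}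
    (hij : i ≠ j) {x : ℝ} (h0 : 0 < x) (h1 : x < 1) (hp : p.1 = edgePt i j x)
    (h : Quot.mk T.Glued (t, p) = Quot.mk T.Glued (t', p')) :
    ∃ i' j', i' ≠ j' ∧ Relation.EqvGen T.EdgeGlued (t, i, j) (t', i', j') ∧
      p'.1 = edgePt i' j' x := by
  refine eqvGen_induction (fun _ _ => Glued.symm)
    (P := fun y : Fin n × stdSimplex ℝ (Fin 4) => ∃ i' j', i' ≠ j' ∧
      Relation.EqvGen T.EdgeGlued (t, i, j) (y.1, i', j') ∧ y.2.1 = edgePt i' j' x)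
    ?_ (Quot.mk_eq_iff_eqvGen.1 h) ⟨i, j, hij, .refl _, hp⟩
  rintro ⟨u, y⟩ ⟨u', y'⟩ ⟨f, π, hg, hf, hy⟩ ⟨i', j', hij', he, hy'⟩
  dsimp only at *
  rw [hy'] at hf
  obtain ⟨hi, hj⟩ := ne_of_edgePt_eq_zero hij' h0 h1 hf
  refine ⟨π i', π j', π.injective.ne hij', he.trans _ _ _
    (.rel _ _ ⟨f, π, hg, hi.symm, hj.symm, rfl, rfl⟩), funext fun k => ?_⟩
  rw [← edgePt_comp, ← hy']
  simp [← hy]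

theorem mk_edgePt_eq {a b : Fin n × Fin 4 × Fin 4} (h : Relation.EqvGen T.EdgeGlued a b) {x : ℝ}
    (h0 : 0 < x) (h1 : x < 1) :
    Quot.mk T.Glued (a.1, ⟨edgePt a.2.1 a.2.2 x, edgePt_mem_stdSimplex _ _ h0 h1⟩) =
      Quot.mk T.Glued (b.1, ⟨edgePt b.2.1 b.2.2 x, edgePt_mem_stdSimplex _ _ h0 h1⟩) := by
  induction h with
  | rel a b h =>
    obtain ⟨f, π, hg, h1, h2, h3, h4⟩ := h
    refine Quot.sound ⟨f, π, hg, edgePt_other h1.symm h2.symm x, fun k => ?_⟩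
    change edgePt b.2.1 b.2.2 x (π k) = edgePt a.2.1 a.2.2 x k
    simp [h3, h4, ← edgePt_comp]
  | refl a => rfl
  | symm a b _ ih => exact ih.symm
  | trans a b c _ _ ih1 ih2 => exact ih1.trans ih2

/-- A point in the interior of a face is identified with at most one other point. -/
theorem eq_or_glued_of_mk_eq {t t' : Fin n} {p p' : stdSimplex ℝ (Fin 4)} {f : Fin 4}
    (hp : ∀ k, p.1 k = 0 ↔ k = f)
    (h : Quot.mk T.Glued (t, p) = Quot.mk T.Glued (t', p')) :
    (t' = t ∧ p' = p) ∨ ∃ π, T.glue t f = some (t', π) ∧ ∀ i, p'.1 (π i) = p.1 i := by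
  refine eqvGen_induction (fun _ _ => Glued.symm)
    (P := fun y : Fin n × stdSimplex ℝ (Fin 4) => (y.1 = t ∧ y.2 = p) ∨
      ∃ π, T.glue t f = some (y.1, π) ∧ ∀ i, y.2.1 (π i) = p.1 i)
    ?_ (Quot.mk_eq_iff_eqvGen.1 h) (Or.inl ⟨rfl, rfl⟩)
  rintro ⟨u, y⟩ ⟨u', y'⟩ ⟨g, σ, hg, hy0, hy⟩ (⟨h1, h2⟩ | ⟨π, hπ, h3⟩)
  · dsimp only at *
    subst h1 h2
    obtain rfl := (hp g).1 hy0
    exact Or.inr ⟨σ, hg, hy⟩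
  · left
    dsimp only at *
    -- The image point is interior to the face `π f`, so the only further gluing that applies to it
    -- is the inverse one.
    have hgf : g = π f := by
      have := h3 (π.symm g)
      rw [Equiv.apply_symm_apply, hy0] at this
      have := (hp _).1 this.symm
      rw [← this, Equiv.apply_symm_apply]
    have h4 := T.glue_symm _ _ _ _ hπ
    rw [← hgf, hg, Option.some.injEq, Prod.mk.injEq] at h4
    refine ⟨h4.1, Subtype.ext (funext fun k => ?_)⟩
    rw [← h3 k, ← hy (π k), h4.2]
    exact congrArg _ (π.symm_apply_apply k).symm

open Classical in
/-- The edges of tetrahedra identified with the edge `ij` of `t`, in both directions. -/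
noncomputable def edgeClass (a : Fin n × Fin 4 × Fin 4) : Finset (Fin n × Fin 4 × Fin 4) :=
  Finset.univ.filter fun b => Relation.EqvGen T.EdgeGlued a b ∨
    Relation.EqvGen T.EdgeGlued (a.1, a.2.2, a.2.1) b

open Classical in
/-- The faces of tetrahedra identified with the face `f` of `t`. -/
noncomputable def faceClass (a : Fin n × Fin 4) : Finset (Fin n × Fin 4) :=
  Finset.univ.filter fun b => b = a ∨ ∃ π, T.glue a.1 a.2 = some (b.1, π) ∧ b.2 = π a.2

end Triangulation

namespace NormalSurface

variable {n : ℕ} {T : Triangulation n}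

/-- The corners of a surface continue along identified edges. -/
theorem exists_disc_of_eqvGen (S : NormalSurface T) {a b : Fin n × Fin 4 × Fin 4}
    (h : Relation.EqvGen T.EdgeGlued a b) {D : NormalDisc} (hD : D ∈ S.discs a.1)
    (hs : D.type.Sep a.2.1 a.2.2) :
    ∃ D' ∈ S.discs b.1, D'.type.Sep b.2.1 b.2.2 ∧ D'.param b.2.1 b.2.2 = D.param a.2.1 a.2.2 := by
  refine Triangulation.eqvGen_induction (fun _ _ => Triangulation.EdgeGlued.symm)
    (P := fun b : Fin n × Fin 4 × Fin 4 => ∃ D' ∈ S.discs b.1, D'.type.Sep b.2.1 b.2.2 ∧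
      D'.param b.2.1 b.2.2 = D.param a.2.1 a.2.2) ?_ h ⟨D, hD, hs, rfl⟩
  rintro ⟨t, i, j⟩ ⟨t', i', j'⟩ ⟨f, π, hg, hi, hj, rfl, rfl⟩ ⟨E, hE, hsE, he⟩
  dsimp only at *
  obtain ⟨E', hE', ha⟩ := S.proper t f t' π hg E hE ⟨_, E.edgePt_mem_arc hsE hi hj⟩
  have := NormalDisc.sep_of_arc_eq ha hsE hi hj
  exact ⟨E', hE', this.1, this.2.trans he⟩

open Classical in
/-- The corners of the surface, each twice, for the two directions of its edge. -/
noncomputable def cornerSet (S : NormalSurface T) :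
    Finset (Σ _ : Fin n, Σ _ : NormalDisc, Fin 4 × Fin 4) :=
  Finset.univ.sigma fun t => (S.discs t).sigma fun D =>
    Finset.univ.filter fun a => D.type.Sep a.1 a.2

theorem mem_cornerSet (S : NormalSurface T) {t D i j} :
    ⟨t, D, i, j⟩ ∈ S.cornerSet ↔ D ∈ S.discs t ∧ D.type.Sep i j := by
  simp [cornerSet]

open Classical in
/-- The point of the underlying space given by a corner. -/
noncomputable def cornerPoint (T : Triangulation n)
    (c : Σ _ : Fin n, Σ _ : NormalDisc, Fin 4 × Fin 4) : T.Space :=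
  Quot.mk T.Glued (c.1, if h : c.2.1.type.Sep c.2.2.1 c.2.2.2 then
    ⟨edgePt c.2.2.1 c.2.2.2 (c.2.1.param c.2.2.1 c.2.2.2),
      edgePt_mem_stdSimplex _ _ (c.2.1.param_mem h).1 (c.2.1.param_mem h).2⟩
    -- A dummy value; only separated pairs occur in `cornerSet`.
    else ⟨Pi.single 0 1, single_mem_stdSimplex ℝ 0⟩)

theorem cornerPoint_eq {t : Fin n} {D : NormalDisc} {i j : Fin 4} (h : D.type.Sep i j) :
    cornerPoint T ⟨t, D, i, j⟩ = Quot.mk T.Glued (t, ⟨edgePt i j (D.param i j),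
      edgePt_mem_stdSimplex _ _ (D.param_mem h).1 (D.param_mem h).2⟩) := by
  simp [cornerPoint, h]
  rfl

/-- Corners at the same point of the underlying space lie on identified edges. -/
theorem eqvGen_of_cornerPoint_eq {t t' : Fin n} {D D' : NormalDisc} {i j i' j' : Fin 4}
    (h : D.type.Sep i j) (h' : D'.type.Sep i' j')
    (he : cornerPoint T ⟨t', D', i', j'⟩ = cornerPoint T ⟨t, D, i, j⟩) :
    (Relation.EqvGen T.EdgeGlued (t, i, j) (t', i', j') ∧ D'.param i' j' = D.param i j) ∨
      (Relation.EqvGen T.EdgeGlued (t, j, i) (t', i', j') ∧ D'.param i' j' = D.param j i) := by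
  rw [cornerPoint_eq h, cornerPoint_eq h'] at he
  obtain ⟨k, l, hkl, hE, hp⟩ := T.exists_edge_of_mk_eq h.ne (D.param_mem h).1 (D.param_mem h).2
    rfl he.symm
  have hm := D'.param_mem h'
  rcases edgePt_inj h'.ne hkl hm.1 hm.2 hp with ⟨rfl, rfl, hx⟩ | ⟨rfl, rfl, hx⟩
  · exact Or.inl ⟨hE, hx⟩
  · exact Or.inr ⟨Triangulation.eqvGen_edgeGlued_swap hE, by rw [hx, D.param_swap h]⟩

theorem cornerPoint_eq_of_eqvGen {t t' : Fin n} {D D' : NormalDisc} {i j i' j' : Fin 4}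
    (h : D.type.Sep i j) (h' : D'.type.Sep i' j')
    (hE : Relation.EqvGen T.EdgeGlued (t, i, j) (t', i', j'))
    (hp : D'.param i' j' = D.param i j) :
    cornerPoint T ⟨t', D', i', j'⟩ = cornerPoint T ⟨t, D, i, j⟩ := by
  rw [cornerPoint_eq h, cornerPoint_eq h']
  simp only [hp]
  exact (T.mk_edgePt_eq hE (D.param_mem h).1 (D.param_mem h).2).symm

theorem cornerPoint_swap {t : Fin n} {D : NormalDisc} {i j : Fin 4} (h : D.type.Sep i j) :
    cornerPoint T ⟨t, D, j, i⟩ = cornerPoint T ⟨t, D, i, j⟩ := by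
  rw [cornerPoint_eq h, cornerPoint_eq h.symm]
  simp only [D.edgePt_param_swap h]
  rfl

open Classical in
theorem vertices_eq (S : NormalSurface T) :
    S.vertices = (S.cornerSet.image (cornerPoint T) : Finset T.Space) := by
  ext q
  simp only [vertices, Triangulation.image, Set.mem_ofPred_eq, Finset.coe_image, Set.mem_image,
    Finset.mem_coe]
  constructor
  · rintro ⟨t, D, hD, p, hp, rfl⟩
    obtain ⟨i, j, hs, hp⟩ := NormalDisc.mem_corners.1 hp
    refine ⟨⟨t, D, i, j⟩, S.mem_cornerSet.2 ⟨hD, hs⟩, ?_⟩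
    rw [cornerPoint_eq hs]
    congr 2
    exact Subtype.ext hp.symm
  · rintro ⟨⟨t, D, i, j⟩, hc, rfl⟩
    obtain ⟨hD, hs⟩ := S.mem_cornerSet.1 hc
    rw [cornerPoint_eq hs]
    exact ⟨t, D, hD, _, NormalDisc.mem_corners.2 ⟨i, j, hs, rfl⟩, rfl⟩

/-- The directed corners at a vertex of the surface correspond one to one to the directed edges in
the class of its edge. Both directions occur in `cornerSet` and in `edgeClass`, so the factor 2
cancels. -/
theorem ncard_vertices (S : NormalSurface T) (hT : T.NoReversedEdge) :
    (S.vertices.ncard : ℚ) = ∑ c ∈ S.cornerSet,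
      ((T.edgeClass (c.1, c.2.2)).card : ℚ)⁻¹ := by
  classical
  rw [S.vertices_eq, Set.ncard_coe_finset]
  refine Finset.card_image_eq_sum_inv _ _ (fun c => (c.1, c.2.2)) _ ?_ ?_
  · rintro ⟨t, D, i, j⟩ hc ⟨t', D', i', j'⟩ hc' hg hh
    obtain ⟨hD, hs⟩ := S.mem_cornerSet.1 hc
    obtain ⟨hD', hs'⟩ := S.mem_cornerSet.1 hc'
    simp only [Prod.mk.injEq] at hh
    obtain ⟨rfl, rfl, rfl⟩ := hh
    -- Two corners at one point, on the same directed edge: either they agree, or the edge is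
    -- identified with its reverse.
    rcases eqvGen_of_cornerPoint_eq hs' hs hg with ⟨-, hp⟩ | ⟨hE, -⟩
    · rw [S.eq_of_param_eq hD hD' hs hs' hp]
    · exact absurd hE.symm (hT _ _ _ hs.ne)
  · rintro ⟨t, D, i, j⟩ hc ⟨t', i', j'⟩
    obtain ⟨hD, hs⟩ := S.mem_cornerSet.1 hc
    simp only [Triangulation.edgeClass, Finset.mem_filter, Finset.mem_univ, true_and]
    constructor
    · rintro (h | h)
      · obtain ⟨D', hD', hs', hp⟩ := S.exists_disc_of_eqvGen h hD hs
        exact ⟨⟨t', D', i', j'⟩, S.mem_cornerSet.2 ⟨hD', hs'⟩,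
          cornerPoint_eq_of_eqvGen hs hs' h hp, rfl⟩
      · obtain ⟨D', hD', hs', hp⟩ := S.exists_disc_of_eqvGen h hD hs.symm
        exact ⟨⟨t', D', i', j'⟩, S.mem_cornerSet.2 ⟨hD', hs'⟩,
          (cornerPoint_eq_of_eqvGen hs.symm hs' h hp).trans (cornerPoint_swap hs), rfl⟩
    · rintro ⟨⟨u, D', k, l⟩, hc', hg, hh⟩
      obtain ⟨hD', hs'⟩ := S.mem_cornerSet.1 hc'
      simp only [Prod.mk.injEq] at hh
      obtain ⟨rfl, rfl, rfl⟩ := hh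
      exact (eqvGen_of_cornerPoint_eq hs hs' hg).imp And.left And.left

open Classical in
/-- The arcs of the surface, each given with a disc. -/
noncomputable def arcSet (S : NormalSurface T) : Finset (Σ _ : Fin n, Σ _ : NormalDisc, Fin 4) :=
  Finset.univ.sigma fun t => (S.discs t).sigma fun D =>
    Finset.univ.filter fun f => ∃ v, D.type.CutsOff f v

theorem mem_arcSet (S : NormalSurface T) {t D f} :
    ⟨t, D, f⟩ ∈ S.arcSet ↔ D ∈ S.discs t ∧ ∃ v, D.type.CutsOff f v := by
  simp [arcSet]

open Classical in
theorem arcs_eq (S : NormalSurface T) :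
    S.arcs = (S.arcSet.image (fun c => T.image c.1 (c.2.1.arc c.2.2)) : Finset (Set T.Space)) := by
  ext q
  simp only [arcs, Set.mem_ofPred_eq, Finset.coe_image, Set.mem_image, Finset.mem_coe]
  constructor
  · rintro ⟨t, D, hD, f, hf, rfl⟩
    exact ⟨⟨t, D, f⟩, S.mem_arcSet.2 ⟨hD, NormalDisc.arc_nonempty_iff.1 hf⟩, rfl⟩
  · rintro ⟨⟨t, D, f⟩, hc, rfl⟩
    obtain ⟨hD, hf⟩ := S.mem_arcSet.1 hc
    exact ⟨t, D, hD, f, NormalDisc.arc_nonempty_iff.2 hf, rfl⟩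

/-- An arc has a point in the interior of its face. -/
theorem _root_.NormalDisc.exists_mem_arc {D : NormalDisc} {f v : Fin 4} (h : D.type.CutsOff f v) :
    ∃ p : stdSimplex ℝ (Fin 4), p.1 ∈ D.arc f ∧ ∀ k, p.1 k = 0 ↔ k = f := by
  obtain ⟨a, b, haf, hbf, hav, hbv, hab, hall⟩ := exists_face_vertices f v h.1
  have ha := D.param_mem (h.sep haf hav)
  have hb := D.param_mem (h.sep hbf hbv)
  have hvf := h.1
  obtain ⟨p, hp⟩ : ∃ p : Fin 4 → ℝ, p = (1 / 2 : ℝ) • edgePt v a (D.param v a) +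
    (1 / 2 : ℝ) • edgePt v b (D.param v b) := ⟨_, rfl⟩
  have hm : p ∈ D.arc f := by
    rw [D.arc_eq_segment h haf hbf hav hbv hall]
    exact ⟨1 / 2, 1 / 2, by norm_num, by norm_num, by norm_num, hp.symm⟩
  refine ⟨⟨p, D.arc_subset_stdSimplex f hm⟩, hm, fun k => ⟨fun hk => ?_, ?_⟩⟩
  · dsimp only at hk
    rcases hall k with rfl | rfl | rfl | rfl
    · rfl
    all_goals
      exfalso
      rw [hp] at hk
      simp [edgePt_left hav.symm, edgePt_left hbv.symm, edgePt_right hav.symm,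
        edgePt_right hbv.symm, edgePt_other hav hab, edgePt_other hbv hab.symm] at hk
      linarith
  · rintro rfl
    exact NormalDisc.arc_apply_self hm

theorem image_arc_eq {t t' : Fin n} {D D' : NormalDisc} {f : Fin 4} {π : Equiv.Perm (Fin 4)}
    (hg : T.glue t f = some (t', π))
    (h : D'.arc (π f) = (fun p i => p (π.symm i)) '' D.arc f) :
    T.image t' (D'.arc (π f)) = T.image t (D.arc f) := by
  ext q
  rw [h]
  constructor
  · rintro ⟨p, ⟨r, hr, hp⟩, rfl⟩
    refine ⟨⟨r, D.arc_subset_stdSimplex f hr⟩, hr, Quot.sound ⟨f, π, hg,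
      NormalDisc.arc_apply_self hr, fun i => ?_⟩⟩
    dsimp only
    rw [← hp]
    simp
  · rintro ⟨p, hp, rfl⟩
    have hmem : (fun i => p.1 (π.symm i)) ∈ D'.arc (π f) := by
      rw [h]
      exact ⟨p.1, hp, rfl⟩
    refine ⟨⟨_, D'.arc_subset_stdSimplex _ hmem⟩, ⟨p.1, hp, rfl⟩, (Quot.sound ⟨f, π, hg,
      NormalDisc.arc_apply_self hp, fun i => ?_⟩).symm⟩
    simp

/-- It suffices to follow one point of the arc in the interior of the face, which is identified with
at most one other point. -/
theorem eq_or_glued_of_image_arc_eq {t t' : Fin n} {D D' : NormalDisc} {f f' v : Fin 4}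
    (h : D.type.CutsOff f v)
    (he : T.image t (D.arc f) = T.image t' (D'.arc f')) :
    (t' = t ∧ f' = f ∧ ∃ p, p ∈ D.arc f ∧ p ∈ D'.arc f') ∨
      ∃ π, T.glue t f = some (t', π) ∧ f' = π f := by
  obtain ⟨p, hp, hp0⟩ := NormalDisc.exists_mem_arc h
  have : Quot.mk T.Glued (t, p) ∈ T.image t' (D'.arc f') := he ▸ ⟨p, hp, rfl⟩
  obtain ⟨p', hp', hq⟩ := this
  have h0 := NormalDisc.arc_apply_self hp'
  rcases T.eq_or_glued_of_mk_eq hp0 hq.symm with ⟨rfl, rfl⟩ | ⟨π, hg, hπ⟩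
  · exact Or.inl ⟨rfl, (hp0 _).1 h0, p'.1, hp, hp'⟩
  · refine Or.inr ⟨π, hg, ?_⟩
    have := hπ (π.symm f')
    rw [Equiv.apply_symm_apply, h0] at this
    rw [← (hp0 _).1 this.symm, Equiv.apply_symm_apply]

/-- The pairs of a disc and a face giving one arc correspond to the members of the face class;
`glue_ne` excludes that a face class folds a face onto itself. -/
theorem ncard_arcs (S : NormalSurface T) :
    (S.arcs.ncard : ℚ) = ∑ c ∈ S.arcSet, ((T.faceClass (c.1, c.2.2)).card : ℚ)⁻¹ := by
  classical
  rw [S.arcs_eq, Set.ncard_coe_finset]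
  refine Finset.card_image_eq_sum_inv _ _ (fun c => (c.1, c.2.2)) _ ?_ ?_
  · rintro ⟨t, D, f⟩ hc ⟨t', D', f'⟩ hc' hg hh
    obtain ⟨hD, v, hv⟩ := S.mem_arcSet.1 hc
    obtain ⟨hD', -⟩ := S.mem_arcSet.1 hc'
    simp only [Prod.mk.injEq] at hh
    obtain ⟨rfl, rfl⟩ := hh
    rcases eq_or_glued_of_image_arc_eq hv hg with ⟨-, -, p, hp, hp'⟩ | ⟨π, hg, hπ⟩
    · rw [S.eq_of_arc_inter hD hD' hp hp']
    · exact absurd (by rw [← hπ]) (T.glue_ne _ _ _ _ hg)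
  · rintro ⟨t, D, f⟩ hc ⟨t', f'⟩
    obtain ⟨hD, v, hv⟩ := S.mem_arcSet.1 hc
    simp only [Triangulation.faceClass, Finset.mem_filter, Finset.mem_univ, true_and]
    constructor
    · rintro (h | ⟨π, hg, hf⟩)
      · exact ⟨_, hc, rfl, h.symm⟩
      · subst hf
        obtain ⟨D', hD', ha⟩ := S.proper _ _ _ _ hg D hD (NormalDisc.arc_nonempty_iff.2 ⟨v, hv⟩)
        exact ⟨⟨t', D', π f⟩, S.mem_arcSet.2 ⟨hD', _, NormalDisc.cutsOff_of_arc_eq ha hv⟩,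
          image_arc_eq hg ha, rfl⟩
    · rintro ⟨⟨u, D', g⟩, -, hg, hh⟩
      simp only [Prod.mk.injEq] at hh
      obtain ⟨rfl, rfl⟩ := hh
      rcases eq_or_glued_of_image_arc_eq hv hg.symm with ⟨rfl, rfl, -⟩ | h
      · exact Or.inl rfl
      · exact Or.inr h

end NormalSurface

/-! ### Linearity of the Euler characteristic. -/

open Classical in
/-- The contribution of a disc to the Euler characteristic. -/
noncomputable def Triangulation.eulerWeight {n : ℕ} (T : Triangulation n) (t : Fin n)
    (τ : DiscType) : ℚ :=
  ∑ a with τ.Sep a.1 a.2, ((T.edgeClass (t, a)).card : ℚ)⁻¹ -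
    ∑ f with ∃ v, τ.CutsOff f v, ((T.faceClass (t, f)).card : ℚ)⁻¹ + 1

/-- The Euler characteristic as a linear function on vectors. -/
noncomputable def Triangulation.euler {n : ℕ} (T : Triangulation n) :
    (Fin n → DiscType → ℚ) →ₗ[ℚ] ℚ where
  toFun x := ∑ t, ∑ τ, T.eulerWeight t τ * x t τ
  map_add' x y := by simp [mul_add, Finset.sum_add_distrib]
  map_smul' c x := by simp [Finset.mul_sum, mul_left_comm]

theorem NormalSurface.eulerChar_eq {n : ℕ} {T : Triangulation n} (hT : T.NoReversedEdge)
    (S : NormalSurface T) : (S.eulerChar : ℚ) = T.euler fun t τ => (S.vec t τ : ℚ) := by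
  classical
  unfold eulerChar
  push_cast
  rw [S.ncard_vertices hT, S.ncard_arcs]
  simp only [cornerSet, arcSet, Finset.sum_sigma, Triangulation.euler, LinearMap.coe_mk,
    AddHom.coe_mk]
  rw [← Finset.sum_sub_distrib, ← Finset.sum_add_distrib]
  refine Finset.sum_congr rfl fun t _ => ?_
  have : ∀ g : DiscType → ℚ, ∑ D ∈ S.discs t, g D.type = ∑ τ, g τ * (S.vec t τ : ℚ) := by
    intro g
    rw [← Finset.sum_fiberwise (S.discs t) (fun D => D.type)]
    refine Finset.sum_congr rfl fun τ _ => ?_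
    rw [Finset.sum_congr rfl (g := fun _ => g τ) (fun D hD => by rw [(Finset.mem_filter.1 hD).2]),
      Finset.sum_const, nsmul_eq_mul, mul_comm]
    rfl
  rw [← this, Finset.cast_card, ← Finset.sum_sub_distrib, ← Finset.sum_add_distrib]
  refine Finset.sum_congr rfl fun D _ => ?_
  simp [Triangulation.eulerWeight]

/-! ### From disc numbers to equally spaced discs. -/

namespace DiscType

theorem exists_quad_cutsOff : ∀ f v : Fin 4, v ≠ f →
    ∃ q : Fin 3, ∀ τ : DiscType, τ.CutsOff f v ↔ τ = tri v ∨ τ = quad q := by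
  decide

theorem exists_mem_side : ∀ τ : DiscType, ∃ i j, i ∈ τ.side ∧ j ∉ τ.side := by
  decide

theorem tri_cutsOff {f v : Fin 4} (h : v ≠ f) : (tri v).CutsOff f v := by
  obtain ⟨q, hq⟩ := exists_quad_cutsOff f v h
  exact (hq _).2 (Or.inl rfl)

end DiscType

/-- A vector of disc numbers in a tetrahedron is admissible if at most one quadrilateral type
occurs. -/
def Admissible (x : DiscType → ℕ) : Prop :=
  ∀ k k' : Fin 3, x (.quad k) ≠ 0 → x (.quad k') ≠ 0 → k = k'

/-- The number of arcs that cut off the vertex `v` of face `f`. -/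
def cutCount (x : DiscType → ℕ) (f v : Fin 4) : ℕ :=
  ∑ τ ∈ DiscType.all.filter (fun τ => τ.CutsOff f v), x τ

/-- The number of intersections with the edge `ij`. -/
def edgeCount (x : DiscType → ℕ) (i j : Fin 4) : ℕ :=
  ∑ τ ∈ DiscType.all.filter (fun τ => τ.Sep i j), x τ

section Counts

variable (x : DiscType → ℕ)

theorem edgeCount_comm (i j : Fin 4) : edgeCount x i j = edgeCount x j i := by
  unfold edgeCount
  congr 1
  exact Finset.filter_congr fun τ _ => ⟨DiscType.Sep.symm, DiscType.Sep.symm⟩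

/-- A disc that separates `v` and `w` meets the face in an arc cutting off exactly one vertex, and
this is `v` or `w`. -/
theorem edgeCount_eq {f v w : Fin 4} (hv : v ≠ f) (hw : w ≠ f) (hvw : v ≠ w) :
    edgeCount x v w = cutCount x f v + cutCount x f w := by
  unfold edgeCount cutCount
  rw [← Finset.sum_union]
  · rw [← Finset.filter_or]
    congr 1
    refine Finset.filter_congr fun τ _ => ⟨fun h => DiscType.exists_cutsOff h hv hw, ?_⟩
    rintro (h | h)
    · exact h.sep hw hvw.symm
    · exact (h.sep hv hvw).symm
  · rw [Finset.disjoint_filter]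
    exact fun τ _ h h' => hvw (h.eq h')

theorem cutCount_eq {f v : Fin 4} {q : Fin 3}
    (hq : ∀ τ : DiscType, τ.CutsOff f v ↔ τ = .tri v ∨ τ = .quad q) :
    cutCount x f v = x (.tri v) + x (.quad q) := by
  have : DiscType.all.filter (fun τ => τ.CutsOff f v) = {.tri v, .quad q} := by
    ext τ
    simp [DiscType.mem_all, hq]
  rw [cutCount, this, Finset.sum_pair (by simp)]

theorem le_edgeCount {i j : Fin 4} (hij : i ≠ j) :
    x (.tri i) + x (.tri j) ≤ edgeCount x i j := by
  obtain ⟨f, hi, hj⟩ := exists_face i j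
  obtain ⟨q, hq⟩ := DiscType.exists_quad_cutsOff f i hi
  obtain ⟨r, hr⟩ := DiscType.exists_quad_cutsOff f j hj
  rw [edgeCount_eq x hi hj hij, cutCount_eq x hq, cutCount_eq x hr]
  omega

theorem le_edgeCount_quad {i j : Fin 4} {q : Fin 3} (h : (DiscType.quad q).Sep i j) :
    x (.tri i) + x (.tri j) + x (.quad q) ≤ edgeCount x i j := by
  obtain ⟨f, hi, hj⟩ := exists_face i j
  obtain ⟨q', hq⟩ := DiscType.exists_quad_cutsOff f i hi
  obtain ⟨r, hr⟩ := DiscType.exists_quad_cutsOff f j hj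
  rw [edgeCount_eq x hi hj h.ne, cutCount_eq x hq, cutCount_eq x hr]
  rcases DiscType.exists_cutsOff h hi hj with h | h
  · rcases (hq _).1 h with h | h
    · simp at h
    · rw [h]; omega
  · rcases (hr _).1 h with h | h
    · simp at h
    · rw [h]; omega

/-- The number of triangles between a disc of type `τ` and the vertex `i` on its side. -/
def offset : DiscType → Fin 4 → ℕ
  | .tri _, _ => 0
  | .quad _, i => x (.tri i)

theorem offset_lt {τ : DiscType} {k : ℕ} (hk : k < x τ) {i j : Fin 4} (hi : i ∈ τ.side)
    (hj : j ∉ τ.side) : offset x τ i + k < edgeCount x i j := by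
  have hij : i ≠ j := fun h => hj (h ▸ hi)
  cases τ with
  | tri v =>
    obtain rfl := Finset.mem_singleton.1 hi
    have := le_edgeCount x hij
    simp only [offset]
    omega
  | quad q =>
    have := le_edgeCount_quad x (i := i) (j := j) (q := q) (by unfold DiscType.Sep; tauto)
    simp only [offset]
    omega

/-- The position, counted from `i`, of the `k`-th disc of type `τ` among the intersections with the
edge `ij`. -/
def rank (τ : DiscType) (k : ℕ) (i j : Fin 4) : ℕ :=
  -- Counted from `j` the rank is `offset x τ j + k + 1`; counted from `i` it is `edgeCount x i j +
  -- 1` minus this, and the ones cancel.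
  if i ∈ τ.side then offset x τ i + k + 1 else edgeCount x i j - (offset x τ j + k)

/-- The `k`-th disc of type `τ`, if the intersections with each edge are equally spaced. -/
noncomputable def spacedDisc (τ : DiscType) (k : Fin (x τ)) : NormalDisc where
  type := τ
  -- The `edgeCount x i j` intersection points cut the edge into one more piece than their number,
  -- whence the denominator.
  pos i j := ⟨(offset x τ i + k + 1 : ℕ) / (edgeCount x i j + 1 : ℕ), by
    have := offset_lt x k.2 i.2 j.2
    constructor
    · positivity
    · rw [div_lt_one (by positivity)]
      exact_mod_cast Nat.succ_lt_succ this⟩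

theorem param_spacedDisc {τ : DiscType} (k : Fin (x τ)) {i j : Fin 4} (h : τ.Sep i j) :
    (spacedDisc x τ k).param i j = (rank x τ k i j : ℝ) / (edgeCount x i j + 1 : ℕ) := by
  rcases NormalDisc.sep_cases h with ⟨hi, hj⟩ | ⟨hj, hi⟩
  · rw [NormalDisc.param_of_mem _ hi hj, rank, if_pos hi]
    rfl
  · rw [NormalDisc.param_of_notMem _ hj hi, rank, if_neg hi]
    have := offset_lt x k.2 hj hi
    rw [edgeCount_comm] at this
    simp only [spacedDisc]
    rw [edgeCount_comm x j i, Nat.cast_sub this.le]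
    push_cast
    field_simp
    ring

variable {x}

/-- Along an edge come first the triangles at `i`, then the discs of at most one quadrilateral type,
then the triangles at `j`. Admissibility is what keeps two quadrilateral types from competing for
the middle ranks. -/
theorem rank_injective (hx : Admissible x) {τ τ' : DiscType} {k : Fin (x τ)} {k' : Fin (x τ')}
    {i j : Fin 4} (h : τ.Sep i j) (h' : τ'.Sep i j) (he : rank x τ k i j = rank x τ' k' i j) :
    (⟨τ, k⟩ : Σ τ, Fin (x τ)) = ⟨τ', k'⟩ := by
  have hij := h.ne
  have hk := k.2
  have hk' := k'.2
  have hN := le_edgeCount x hij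
  have key : τ = τ' → (⟨τ, k⟩ : Σ τ, Fin (x τ)) = ⟨τ', k'⟩ := by
    rintro rfl
    congr 1
    apply Fin.ext
    rcases NormalDisc.sep_cases h with ⟨hi, hj⟩ | ⟨hj, hi⟩
    · simp only [rank, if_pos hi] at he
      omega
    · have h1 := offset_lt x hk hj hi
      have h2 := offset_lt x hk' hj hi
      rw [edgeCount_comm] at h1 h2
      simp only [rank, if_neg hi] at he
      omega
  apply key
  have tri_side : ∀ v, (DiscType.tri v).Sep i j → v = i ∨ v = j := by
    intro v hv
    simp only [DiscType.Sep, DiscType.side, Finset.mem_singleton] at hv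
    by_contra hc
    push Not at hc
    exact hc.1 (hv.2 (fun e => hc.2 e.symm)).symm
  cases τ with
  | tri v =>
    cases τ' with
    | tri v' =>
      rcases tri_side v h with rfl | rfl <;> rcases tri_side v' h' with rfl | rfl <;>
        simp [rank, offset, DiscType.side, hij, hij.symm] at he ⊢ <;> omega
    | quad q' =>
      have := le_edgeCount_quad x h'
      rcases tri_side v h with rfl | rfl <;>
        rcases NormalDisc.sep_cases h' with ⟨hi, hj⟩ | ⟨hj, hi⟩ <;>
        simp only [rank, offset, hi, if_true, if_false] at he <;>
        simp [DiscType.side, hij] at he <;> omega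
  | quad q =>
    have := le_edgeCount_quad x h
    cases τ' with
    | tri v' =>
      rcases tri_side v' h' with rfl | rfl <;>
        rcases NormalDisc.sep_cases h with ⟨hi, hj⟩ | ⟨hj, hi⟩ <;>
        simp only [rank, offset, hi, if_true, if_false] at he <;>
        simp [DiscType.side, hij] at he <;> omega
    | quad q' => rw [hx q q' (by omega) (by omega)]

theorem spacedDisc_eq_of_param_eq (hx : Admissible x) {τ τ' : DiscType} {k : Fin (x τ)}
    {k' : Fin (x τ')} {i j : Fin 4} (h : τ.Sep i j) (h' : τ'.Sep i j)
    (he : (spacedDisc x τ k).param i j = (spacedDisc x τ' k').param i j) :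
    (⟨τ, k⟩ : Σ τ, Fin (x τ)) = ⟨τ', k'⟩ := by
  refine rank_injective hx h h' ?_
  rw [param_spacedDisc x k h, param_spacedDisc x k' h', div_left_inj' (by positivity)] at he
  exact_mod_cast he

variable (x) in
/-- The position, counted from `v`, of the `k`-th disc of type `τ` among those that cut off the
vertex `v` of face `f`. -/
def depth (τ : DiscType) (k : ℕ) (f v : Fin 4) : ℕ :=
  if v ∈ τ.side then offset x τ v + k + 1 else cutCount x f v - k

/-- The rank along `va` depends on the face and on `v` only, not on `a`. For a quadrilateral whose
side misses `v`, admissibility leaves only triangles among the discs that cut off `a`. -/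
theorem rank_eq_depth (hx : Admissible x) {τ : DiscType} {k : ℕ} (hk : k < x τ) {f v a : Fin 4}
    (h : τ.CutsOff f v) (ha : a ≠ f) (hav : a ≠ v) : rank x τ k v a = depth x τ k f v := by
  unfold rank depth
  split_ifs with hv
  · rfl
  · obtain ⟨q, hq⟩ := DiscType.exists_quad_cutsOff f v h.1
    obtain ⟨r, hr⟩ := DiscType.exists_quad_cutsOff f a ha
    rcases (hq τ).1 h with rfl | rfl
    · simp [DiscType.side] at hv
    · have hr0 : x (.quad r) = 0 := by
        by_contra hr0
        obtain rfl := hx q r (by omega) hr0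
        exact hav (((hr _).2 (Or.inr rfl)).eq h)
      rw [edgeCount_eq x h.1 ha hav.symm, cutCount_eq x hr, hr0]
      simp only [offset]
      omega

theorem depth_mem {τ : DiscType} {k : ℕ} (hk : k < x τ) {f v : Fin 4}
    (h : τ.CutsOff f v) : 1 ≤ depth x τ k f v ∧ depth x τ k f v ≤ cutCount x f v := by
  obtain ⟨q, hq⟩ := DiscType.exists_quad_cutsOff f v h.1
  unfold depth
  rw [cutCount_eq x hq]
  rcases (hq τ).1 h with rfl | rfl <;> simp only [offset] <;> split_ifs <;> omega

theorem exists_depth_eq {f v : Fin 4} (hv : v ≠ f) {m : ℕ} (h1 : 1 ≤ m)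
    (h2 : m ≤ cutCount x f v) :
    ∃ (τ : DiscType) (k : Fin (x τ)), τ.CutsOff f v ∧ depth x τ k f v = m := by
  obtain ⟨q, hq⟩ := DiscType.exists_quad_cutsOff f v hv
  rw [cutCount_eq x hq] at h2
  by_cases hm : m ≤ x (.tri v)
  · refine ⟨.tri v, ⟨m - 1, by omega⟩, DiscType.tri_cutsOff hv, ?_⟩
    simp [depth, DiscType.side, offset]
    omega
  · by_cases hs : v ∈ (DiscType.quad q).side
    · refine ⟨.quad q, ⟨m - x (.tri v) - 1, by omega⟩, (hq _).2 (Or.inr rfl), ?_⟩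
      rw [depth, if_pos hs]
      simp only [offset]
      omega
    · refine ⟨.quad q, ⟨x (.tri v) + x (.quad q) - m, by omega⟩, (hq _).2 (Or.inr rfl), ?_⟩
      rw [depth, if_neg hs, cutCount_eq x hq]
      exact Nat.sub_sub_self h2

/-- The position is expressed through arc numbers in the face alone. The matching equations preserve
these numbers, so corners with equal depth agree across a gluing. -/
theorem param_eq_depth (hx : Admissible x) {τ : DiscType} (k : Fin (x τ)) {f v a : Fin 4}
    (h : τ.CutsOff f v) (ha : a ≠ f) (hav : a ≠ v) :
    (spacedDisc x τ k).param v a =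
      (depth x τ k f v : ℝ) / (cutCount x f v + cutCount x f a + 1 : ℕ) := by
  rw [param_spacedDisc x k (h.sep ha hav), rank_eq_depth hx k.2 h ha hav,
    edgeCount_eq x h.1 ha hav.symm]

end Counts

/-! ### Disjointness of the spaced discs and realisation of admissible vectors. -/

/-- Two arcs in a triangle that cut off different vertices are disjoint if their end points on the
common edge are in the right order. -/
theorem arcs_not_cross {A B α β s t s' t' : ℝ} (hA : 0 < A) (hA1 : A < 1) (hB : 0 < B)
    (hB1 : B < 1) (hα : 0 < α) (hαβ : α < β) (hβ : β < 1) (hs' : 0 ≤ s') (ht' : 0 ≤ t')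
    (hst : s + t = 1) (hst' : s' + t' = 1) (h1 : s * A = s' * B)
    (h2 : t * α = t' * β + s' * (1 - B)) : False := by
  -- Eliminating `s` and `t` leaves a non-negative combination with positive coefficients that
  -- vanishes.
  have e : t' * (A * (β - α)) + s' * (A * (1 - B) * (1 - α) + α * B * (1 - A)) = 0 := by
    linear_combination (-α) * h1 - A * h2 - α * A * hst' + α * A * hst
  have p1 : 0 < A * (β - α) := mul_pos hA (sub_pos.2 hαβ)
  have p2 : 0 < A * (1 - B) * (1 - α) + α * B * (1 - A) :=
    add_pos (mul_pos (mul_pos hA (sub_pos.2 hB1)) (sub_pos.2 (hαβ.trans hβ)))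
      (mul_pos (mul_pos hα hB) (sub_pos.2 hA1))
  rcases hs'.eq_or_lt with rfl | hs
  · obtain rfl : t' = 1 := by linarith
    linarith
  · nlinarith [mul_nonneg ht' p1.le, mul_pos hs p2]

/-- Arcs cutting off the same vertex lie on parallel lines indexed by the depth. Arcs cutting off
different vertices have their ends on the common edge in the right order. Arcs in different faces
can only meet in a corner. -/
theorem disjoint_spacedDisc {x : DiscType → ℕ} (hx : Admissible x) {τ τ' : DiscType}
    {k : Fin (x τ)} {k' : Fin (x τ')} (hne : (⟨τ, k⟩ : Σ τ, Fin (x τ)) ≠ ⟨τ', k'⟩) :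
    Disjoint (spacedDisc x τ k).boundary (spacedDisc x τ' k').boundary := by
  refine Set.disjoint_left.2 fun p hp hp' => ?_
  obtain ⟨f, hf⟩ := Set.mem_iUnion.1 hp
  obtain ⟨g, hg⟩ := Set.mem_iUnion.1 hp'
  by_cases hfg : f = g
  · subst hfg
    obtain ⟨v, hv⟩ := NormalDisc.arc_nonempty_iff.1 ⟨p, hf⟩
    obtain ⟨w, hw⟩ := NormalDisc.arc_nonempty_iff.1 ⟨p, hg⟩
    by_cases hvw : v = w
    · subst hvw
      obtain ⟨a, b, haf, hbf, hav, hbv, hab, hall⟩ := exists_face_vertices f v hv.1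
      obtain ⟨s, t, hs, ht, hst, -, -, hpa, hpb⟩ :=
        (NormalDisc.mem_arc_iff _ hv haf hbf hav hbv hab hall p).1 hf
      obtain ⟨s', t', hs', ht', hst', -, -, hpa', hpb'⟩ :=
        (NormalDisc.mem_arc_iff _ hw haf hbf hav hbv hab hall p).1 hg
      rw [param_eq_depth hx k hv haf hav] at hpa
      rw [param_eq_depth hx k hv hbf hbv] at hpb
      rw [param_eq_depth hx k' hw haf hav] at hpa'
      rw [param_eq_depth hx k' hw hbf hbv] at hpb'
      rw [hpa] at hpa'
      rw [hpb] at hpb'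
      field_simp at hpa' hpb'
      -- Scaling the two coordinates by their denominators and adding recovers the depth from the
      -- point, because the segment weights sum to 1.
      have hd : (depth x τ k f v : ℝ) = depth x τ' k' f v := by
        linear_combination hpa' + hpb' - (depth x τ k f v : ℝ) * hst +
          (depth x τ' k' f v : ℝ) * hst'
      refine hne (rank_injective hx (hv.sep haf hav) (hw.sep haf hav) ?_)
      rw [rank_eq_depth hx k.2 hv haf hav, rank_eq_depth hx k'.2 hw haf hav]
      exact_mod_cast hd
    · obtain ⟨a, haf, hav, haw, hall⟩ := exists_third_vertex hv.1 hw.1 hvw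
      have hs1 := hv.sep hw.1 (Ne.symm hvw)
      have hs2 := hw.sep hv.1 hvw
      obtain ⟨s, t, hs, ht, hst, -, -, hpa, hpw⟩ :=
        (NormalDisc.mem_arc_iff _ hv haf hw.1 hav (Ne.symm hvw) haw hall p).1 hf
      obtain ⟨s', t', hs', ht', hst', -, hpw', hpa', hpv'⟩ :=
        (NormalDisc.mem_arc_iff _ hw haf hv.1 haw hvw hav
          (fun x => by have := hall x; tauto) p).1 hg
      have hA := (spacedDisc x τ k).param_mem (hv.sep haf hav)
      have hB := (spacedDisc x τ' k').param_mem (hw.sep haf haw)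
      have hα := (spacedDisc x τ k).param_mem hs1
      have hβ := (spacedDisc x τ' k').param_mem hs2.symm
      have hsw := (spacedDisc x τ' k').param_swap hs2.symm
      refine arcs_not_cross hA.1 hA.2 hB.1 hB.2 hα.1 ?_ hβ.2 hs' ht' hst hst' (hpa.symm.trans hpa')
        (β := (spacedDisc x τ' k').param v w) ?_
      · have hlt : (spacedDisc x τ k).param v w + (spacedDisc x τ' k').param w v < 1 := by
          have d1 := (depth_mem k.2 hv).2
          have d2 := (depth_mem k'.2 hw).2
          rw [param_eq_depth hx k hv hw.1 (Ne.symm hvw), param_eq_depth hx k' hw hv.1 hvw,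
            add_comm (cutCount x f w), ← add_div, div_lt_one (by positivity)]
          exact_mod_cast (by omega)
        linarith
      · rw [← hpw, hpw', hsw]
        linear_combination - hst'
  · obtain ⟨i, j, hs, rfl⟩ := NormalDisc.mem_corners.1
      (NormalDisc.mem_corners_of_mem_arc hf (Ne.symm hfg) (NormalDisc.arc_apply_self hg))
    have hm := (spacedDisc x τ k).param_mem hs
    obtain ⟨hs', he⟩ := (NormalDisc.edgePt_mem_corners_iff hs.ne hm.1 hm.2).1
      (NormalDisc.mem_corners_of_mem_arc hg hfg (NormalDisc.arc_apply_self hf))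
    exact hne (spacedDisc_eq_of_param_eq hx hs hs' he)

theorem spacedDisc_injective {x : DiscType → ℕ} (hx : Admissible x) :
    Function.Injective fun s : Σ τ, Fin (x τ) => spacedDisc x s.1 s.2 := by
  rintro ⟨τ, k⟩ ⟨τ', k'⟩ h
  obtain rfl : τ = τ' := congrArg NormalDisc.type h
  obtain ⟨i, j, hi, hj⟩ := DiscType.exists_mem_side τ
  have hs : τ.Sep i j := by unfold DiscType.Sep; tauto
  exact spacedDisc_eq_of_param_eq hx hs hs (congrArg (fun D => D.param i j) h)

open Classical in
/-- Admissible solutions of the matching equations are represented by normal surfaces. -/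
theorem Triangulation.Matching.exists_surface {n : ℕ} {T : Triangulation n}
    {x : Fin n → DiscType → ℕ} (hm : T.Matching x) (hx : ∀ t, Admissible (x t)) :
    ∃ S : NormalSurface T, S.vec = x := by
  refine ⟨⟨fun t => Finset.univ.image fun s : Σ τ, Fin (x t τ) => spacedDisc (x t) s.1 s.2,
    ?_, ?_⟩, ?_⟩
  · intro t D hD D' hD' hne
    simp only [Finset.mem_image, Finset.mem_univ, true_and] at hD hD'
    obtain ⟨⟨τ, k⟩, rfl⟩ := hD
    obtain ⟨⟨τ', k'⟩, rfl⟩ := hD'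
    exact disjoint_spacedDisc (hx t) fun h => hne (by rw [h])
  · intro t f t' π hg D hD hf
    simp only [Finset.mem_image, Finset.mem_univ, true_and] at hD
    obtain ⟨⟨τ, k⟩, rfl⟩ := hD
    obtain ⟨v, hv⟩ := NormalDisc.arc_nonempty_iff.1 hf
    have hcut : ∀ w, w ≠ f → cutCount (x t') (π f) (π w) = cutCount (x t) f w :=
      fun w hw => (hm t f t' π hg w hw).symm
    have hd := depth_mem k.2 hv
    rw [← hcut v hv.1] at hd
    -- The continuation across the face is the disc of equal depth on the other side; the equal arc
    -- numbers make it exist.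
    obtain ⟨τ', k', hv', hd'⟩ := exists_depth_eq (π.injective.ne hv.1) hd.1 hd.2
    refine ⟨spacedDisc (x t') τ' k', Finset.mem_image.2 ⟨⟨τ', k'⟩, Finset.mem_univ _, rfl⟩,
      NormalDisc.arc_eq_of_param_eq hv hv' fun w hw hwv => ?_⟩
    rw [param_eq_depth (hx t) k hv hw hwv, param_eq_depth (hx t') k' hv' (π.injective.ne hw)
      (π.injective.ne hwv), hd', hcut v hv.1, hcut w hw]
  · funext t τ
    unfold NormalSurface.vec
    dsimp only
    rw [Finset.filter_image, Finset.card_image_of_injective _ (spacedDisc_injective (hx t))]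
    have : (Finset.univ.filter fun s : Σ τ, Fin (x t τ) => (spacedDisc (x t) s.1 s.2).type = τ) =
        Finset.univ.image (Sigma.mk τ) := by
      ext ⟨σ, k⟩
      simp only [Finset.mem_filter, Finset.mem_univ, true_and, Finset.mem_image]
      constructor
      · intro h
        obtain rfl : σ = τ := h
        exact ⟨k, rfl⟩
      · rintro ⟨l, h⟩
        exact (congrArg Sigma.fst h).symm
    rw [this, Finset.card_image_of_injective _ sigma_mk_injective, Finset.card_univ,
      Fintype.card_fin]

/-! ### Linear algebra of the matching equations. -/

namespace Triangulation.Matching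

variable {n : ℕ} {T : Triangulation n}

theorem map {R R' : Type*} [AddCommMonoid R] [AddCommMonoid R'] {x : Fin n → DiscType → R}
    (h : T.Matching x) (φ : R →+ R') : T.Matching fun t τ => φ (x t τ) := by
  intro t f t' π hg v hv
  rw [← map_sum, ← map_sum, h t f t' π hg v hv]

theorem of_map {R R' : Type*} [AddCommMonoid R] [AddCommMonoid R'] {x : Fin n → DiscType → R}
    {φ : R →+ R'} (hφ : Function.Injective φ) (h : T.Matching fun t τ => φ (x t τ)) :
    T.Matching x := by
  intro t f t' π hg v hv
  apply hφ
  rw [map_sum, map_sum, h t f t' π hg v hv]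

theorem add {R : Type*} [AddCommMonoid R] {x y : Fin n → DiscType → R} (hx : T.Matching x)
    (hy : T.Matching y) : T.Matching (x + y) := by
  intro t f t' π hg v hv
  simp only [Pi.add_apply, Finset.sum_add_distrib]
  rw [hx t f t' π hg v hv, hy t f t' π hg v hv]

theorem smul {R : Type*} [CommSemiring R] {x : Fin n → DiscType → R} (hx : T.Matching x) (c : R) :
    T.Matching (c • x) :=
  hx.map (AddMonoidHom.mulLeft c)

end Triangulation.Matching

theorem exists_common_denominator {ι : Type*} [Fintype ι] {y : ι → ℚ} (h : ∀ i, 0 ≤ y i) :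
    ∃ (k : ℕ) (z : ι → ℕ), 0 < k ∧ ∀ i, (z i : ℚ) = k * y i := by
  classical
  refine ⟨∏ i, (y i).den, fun i => (y i).num.toNat * ∏ j ∈ Finset.univ.erase i, (y j).den,
    Finset.prod_pos fun i _ => (y i).den_pos, fun i => ?_⟩
  rw [← Finset.mul_prod_erase _ _ (Finset.mem_univ i)]
  have h1 : (((y i).num.toNat : ℕ) : ℚ) = (y i).num := by
    exact_mod_cast Int.toNat_of_nonneg (Rat.num_nonneg.2 (h i))
  have h2 := Rat.den_mul_eq_num (y i)
  push_cast
  rw [h1, ← h2]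
  ring

/-- Moving from a positive vector in a direction that is somewhere negative, one reaches a
coordinate hyperplane. -/
theorem exists_boundary_point {ι : Type*} [Fintype ι] {v w : ι → ℚ} (hv : ∀ i, 0 ≤ v i)
    (hsupp : ∀ i, v i = 0 → w i = 0) (hw : ∃ i, w i < 0) :
    ∃ s : ℚ, (∀ i, 0 ≤ v i + s * w i) ∧ ∃ i, v i ≠ 0 ∧ v i + s * w i = 0 := by
  classical
  obtain ⟨i₀, hi₀⟩ := hw
  -- The ratio test: the smallest ratio is the first time at which a decreasing coordinate vanishes.
  obtain ⟨i, hi, hmin⟩ := Finset.exists_min_image (Finset.univ.filter fun i => w i < 0)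
    (fun i => v i / (-w i)) ⟨i₀, by simpa using hi₀⟩
  have hwi : w i < 0 := (Finset.mem_filter.1 hi).2
  refine ⟨v i / (-w i), fun j => ?_, i, fun h => hwi.ne (hsupp i h), ?_⟩
  · rcases lt_or_ge (w j) 0 with hj | hj
    · have := hmin j (by simpa using hj)
      rw [le_div_iff₀ (neg_pos.2 hj)] at this
      linarith
    · exact add_nonneg (hv j) (mul_nonneg (div_nonneg (hv i) (neg_pos.2 hwi).le) hj)
  · have := hwi.ne
    field_simp
    ring

/-! ### Surfaces of minimal support and the extreme ray. -/

namespace NormalSurface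

variable {n : ℕ} {T : Triangulation n}

/-- `S` has positive Euler characteristic, and no normal surface with positive Euler characteristic
has a smaller support. -/
def MinimalSupport (S : NormalSurface T) : Prop :=
  0 < S.eulerChar ∧ ¬ ∃ S' : NormalSurface T, 0 < S'.eulerChar ∧
    (∀ t τ, S.vec t τ = 0 → S'.vec t τ = 0) ∧ ∃ t τ, S.vec t τ ≠ 0 ∧ S'.vec t τ = 0

theorem admissible_of_support (S : NormalSurface T) {x : Fin n → DiscType → ℕ}
    (h : ∀ t τ, S.vec t τ = 0 → x t τ = 0) (t : Fin n) : Admissible (x t) :=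
  fun _ _ hk hk' => S.quad_eq (fun e => hk (h _ _ e)) (fun e => hk' (h _ _ e))

theorem matching_vec_rat (S : NormalSurface T) : T.Matching fun t τ => (S.vec t τ : ℚ) :=
  S.matching_vec.map (Nat.castAddMonoidHom ℚ)

/-- On rational points of the matching cone whose support is strictly smaller than that of a surface
of minimal support, the Euler characteristic is not positive. -/
theorem MinimalSupport.euler_nonpos {S : NormalSurface T} (hS : S.MinimalSupport)
    (hT : T.NoReversedEdge) {y : Fin n → DiscType → ℚ} (hy : T.Matching y)
    (h0 : ∀ t τ, 0 ≤ y t τ) (hsupp : ∀ t τ, S.vec t τ = 0 → y t τ = 0)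
    (hlt : ∃ t τ, S.vec t τ ≠ 0 ∧ y t τ = 0) : T.euler y ≤ 0 := by
  by_contra! hpos
  obtain ⟨k, z, hk, hz⟩ := exists_common_denominator (y := fun p : Fin n × DiscType => y p.1 p.2)
    fun p => h0 p.1 p.2
  have hk' : (0 : ℚ) < k := by exact_mod_cast hk
  have hzero : ∀ t τ, y t τ = 0 → z (t, τ) = 0 := by
    intro t τ h
    have := hz (t, τ)
    rw [h, mul_zero] at this
    exact_mod_cast this
  have hzy : (fun t τ => (z (t, τ) : ℚ)) = (k : ℚ) • y := by
    funext t τ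
    exact hz (t, τ)
  have hm : T.Matching fun t τ => z (t, τ) := by
    refine Triangulation.Matching.of_map (φ := Nat.castAddMonoidHom ℚ) Nat.cast_injective ?_
    exact (congrArg T.Matching hzy).mpr (hy.smul _)
  have hsz : ∀ t τ, S.vec t τ = 0 → z (t, τ) = 0 := fun t τ h => hzero t τ (hsupp t τ h)
  obtain ⟨S', hS'⟩ := hm.exists_surface (S.admissible_of_support hsz)
  refine hS.2 ⟨S', ?_, ?_, ?_⟩
  · have := S'.eulerChar_eq hT
    rw [hS', hzy, map_smul, smul_eq_mul] at this
    have : (0 : ℚ) < S'.eulerChar := this ▸ mul_pos hk' hpos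
    exact_mod_cast this
  · rw [hS']
    exact hsz
  · obtain ⟨t, τ, h1, h2⟩ := hlt
    exact ⟨t, τ, h1, by rw [hS']; exact hzero t τ h2⟩

/-- Moving from the vector of `S` along `w` does not change the Euler characteristic. A negative
coordinate would lead to a point of the cone with smaller support where it is still positive. -/
theorem MinimalSupport.nonneg_of_euler_eq_zero {S : NormalSurface T} (hS : S.MinimalSupport)
    (hT : T.NoReversedEdge) {w : Fin n → DiscType → ℚ} (hw : T.Matching w)
    (hsupp : ∀ t τ, S.vec t τ = 0 → w t τ = 0) (he : T.euler w = 0) (t : Fin n) (τ : DiscType) :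
    0 ≤ w t τ := by
  by_contra! hneg
  obtain ⟨s, hs, ⟨t', τ'⟩, h1, h2⟩ := exists_boundary_point
    (v := fun p : Fin n × DiscType => (S.vec p.1 p.2 : ℚ)) (w := fun p => w p.1 p.2)
    (fun p => Nat.cast_nonneg _) (fun p hp => hsupp _ _ (by exact_mod_cast hp)) ⟨(t, τ), hneg⟩
  have := hS.euler_nonpos hT (S.matching_vec_rat.add (hw.smul s)) (fun t τ => hs (t, τ))
    (fun t τ h => by simp [h, hsupp t τ h]) ⟨t', τ', by exact_mod_cast h1, h2⟩
  rw [map_add, map_smul, he, smul_zero, add_zero, ← S.eulerChar_eq hT] at this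
  exact absurd hS.1 (not_lt.2 (by exact_mod_cast this))

/-- The rational solutions of the matching equations in the support of a surface of minimal
support are the multiples of its vector. -/
theorem MinimalSupport.exists_eq_mul {S : NormalSurface T} (hS : S.MinimalSupport)
    (hT : T.NoReversedEdge) {w : Fin n → DiscType → ℚ} (hw : T.Matching w)
    (hsupp : ∀ t τ, S.vec t τ = 0 → w t τ = 0) : ∃ q : ℚ, ∀ t τ, w t τ = q * S.vec t τ := by
  have hpos : (0 : ℚ) < T.euler fun t τ => (S.vec t τ : ℚ) := by
    rw [← S.eulerChar_eq hT]
    exact_mod_cast hS.1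
  obtain ⟨q, hq⟩ : ∃ q, T.euler w = q * T.euler fun t τ => (S.vec t τ : ℚ) :=
    ⟨_, (div_mul_cancel₀ _ hpos.ne').symm⟩
  have hm := hw.add (S.matching_vec_rat.smul (-q))
  have hs : ∀ t τ, S.vec t τ = 0 → (w + (-q) • fun t τ => (S.vec t τ : ℚ)) t τ = 0 :=
    fun t τ h => by simp [h, hsupp t τ h]
  have he : T.euler (w + (-q) • fun t τ => (S.vec t τ : ℚ)) = 0 := by
    rw [map_add, map_smul, hq, smul_eq_mul]
    ring
  refine ⟨q, fun t τ => ?_⟩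
  have h1 := hS.nonneg_of_euler_eq_zero hT hm hs he t τ
  -- The same argument for the negated vector forces equality.
  have h2 := hS.nonneg_of_euler_eq_zero hT (hm.smul (-1)) (fun t τ h => by simp [h, hsupp t τ h])
    (by rw [map_smul, he, smul_zero]) t τ
  simp only [Pi.add_apply, Pi.smul_apply, smul_eq_mul] at h1 h2
  linarith

theorem exists_vec_ne_zero {S : NormalSurface T} (hS : 0 < S.eulerChar) (hT : T.NoReversedEdge) :
    ∃ t τ, S.vec t τ ≠ 0 := by
  by_contra! h
  have := S.eulerChar_eq hT
  have h0 : (fun t τ => (S.vec t τ : ℚ)) = 0 := by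
    funext t τ
    simp [h t τ]
  rw [h0, map_zero] at this
  have : S.eulerChar = 0 := by exact_mod_cast this
  omega

theorem MinimalSupport.isExtreme {S : NormalSurface T} (hS : S.MinimalSupport)
    (hT : T.NoReversedEdge) : IsExtreme ℝ T.matchingCone
      {x | ∃ a : ℝ, 0 ≤ a ∧ x = a • fun t τ => (S.vec t τ : ℝ)} := by
  refine ⟨?_, ?_⟩
  · rintro _ ⟨a, ha, rfl⟩
    exact ⟨fun t τ => mul_nonneg ha (Nat.cast_nonneg _),
      Triangulation.Matching.smul (S.matching_vec.map (Nat.castAddMonoidHom ℝ)) a⟩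
  · rintro x hx y hy z ⟨a, -, rfl⟩ ⟨s, r, hs, hr, -, hz⟩
    have hsupp : ∀ t τ, S.vec t τ = 0 → x t τ = 0 := by
      intro t τ h
      have h1 := congrFun (congrFun hz t) τ
      simp only [Pi.add_apply, Pi.smul_apply, smul_eq_mul, h, Nat.cast_zero, mul_zero] at h1
      -- Where the combination of two non-negative coordinates vanishes, both vanish, so `x` stays
      -- in the support of `S`.
      have := mul_nonneg hr.le (hy.1 t τ)
      exact le_antisymm (by nlinarith) (hx.1 t τ)
    obtain ⟨t₀, τ₀, h₀⟩ := exists_vec_ne_zero hS.1 hT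
    have h₀' : (0 : ℝ) < S.vec t₀ τ₀ := by exact_mod_cast Nat.pos_of_ne_zero h₀
    refine ⟨x t₀ τ₀ / S.vec t₀ τ₀, div_nonneg (hx.1 _ _) h₀'.le, ?_⟩
    funext t τ
    -- A ℚ-linear functional turns the real solution `x` into a rational one, which is a multiple of
    -- the vector of `S`. Such functionals separate the points of ℝ, so the proportionality holds
    -- for `x` itself.
    have key : (S.vec t₀ τ₀ : ℚ) • x t τ - (S.vec t τ : ℚ) • x t₀ τ₀ = 0 := by
      rw [← Module.forall_dual_apply_eq_zero_iff ℚ]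
      intro φ
      obtain ⟨q, hq⟩ := hS.exists_eq_mul hT (w := fun t τ => φ (x t τ))
        (Triangulation.Matching.map (R := ℝ) hx.2 φ.toAddMonoidHom)
        (fun t τ h => by rw [hsupp t τ h, map_zero])
      rw [map_sub, map_smul, map_smul, hq, hq, smul_eq_mul, smul_eq_mul]
      ring
    simp only [Rat.smul_def, Rat.cast_natCast] at key
    simp only [Pi.smul_apply, smul_eq_mul]
    field_simp
    linarith

/-! ### Unions of components and connectedness. -/

/-- The surface formed by the discs of `S` with a property that is constant on components. -/
def filter (S : NormalSurface T) (P : (t : Fin n) → NormalDisc → Prop)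
    [∀ t, DecidablePred (P t)]
    (hP : ∀ a b : Σ t, {D // D ∈ S.discs t}, S.Meet a b → P a.1 a.2.1 → P b.1 b.2.1) :
    NormalSurface T where
  discs t := (S.discs t).filter (P t)
  disjoint t D hD D' hD' :=
    S.disjoint t D (Finset.mem_filter.1 hD).1 D' (Finset.mem_filter.1 hD').1
  proper t f t' π hg D hD hf := by
    obtain ⟨hD, hPD⟩ := Finset.mem_filter.1 hD
    obtain ⟨D', hD', h⟩ := S.proper t f t' π hg D hD hf
    refine ⟨D', Finset.mem_filter.2 ⟨hD', hP ⟨t, D, hD⟩ ⟨t', D', hD'⟩ ?_ hPD⟩, h⟩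
    obtain ⟨p, hp⟩ := hf
    have hq : Quot.mk T.Glued (t, ⟨p, D.arc_subset_stdSimplex f hp⟩) ∈ T.image t (D.arc f) :=
      ⟨_, hp, rfl⟩
    refine ⟨_, ⟨⟨p, D.arc_subset_stdSimplex f hp⟩, D.arc_subset_boundary f hp, rfl⟩, ?_⟩
    rw [← image_arc_eq hg h] at hq
    obtain ⟨p', hp', he⟩ := hq
    exact ⟨p', D'.arc_subset_boundary _ hp', he⟩

theorem vec_filter_le (S : NormalSurface T) (P : (t : Fin n) → NormalDisc → Prop)
    [∀ t, DecidablePred (P t)] (hP) (t : Fin n) (τ : DiscType) :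
    (S.filter P hP).vec t τ ≤ S.vec t τ :=
  Finset.card_le_card (Finset.filter_subset_filter _ (Finset.filter_subset _ _))

theorem vec_pos (S : NormalSurface T) {t : Fin n} {D : NormalDisc} (hD : D ∈ S.discs t) :
    0 < S.vec t D.type :=
  Finset.card_pos.2 ⟨D, Finset.mem_filter.2 ⟨hD, rfl⟩⟩

theorem vec_filter_lt (S : NormalSurface T) (P : (t : Fin n) → NormalDisc → Prop)
    [∀ t, DecidablePred (P t)] (hP) {t : Fin n} {D : NormalDisc} (hD : D ∈ S.discs t)
    (h : ¬ P t D) : (S.filter P hP).vec t D.type < S.vec t D.type := by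
  refine Finset.card_lt_card (Finset.ssubset_iff_of_subset
    (Finset.filter_subset_filter _ (Finset.filter_subset _ _)) |>.2
    ⟨D, Finset.mem_filter.2 ⟨hD, rfl⟩, fun hc => h ?_⟩)
  exact (Finset.mem_filter.1 (Finset.mem_filter.1 hc).1).2

/-- A surface is connected if its vector is not a sum of two vectors of surfaces. -/
theorem connected_of_forall_vec (S : NormalSurface T) (hne : ∃ t τ, S.vec t τ ≠ 0)
    (h : ∀ S' : NormalSurface T, (∀ t τ, S'.vec t τ ≤ S.vec t τ) → (∃ t τ, S'.vec t τ ≠ 0) →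
      S'.vec = S.vec) : S.Connected := by
  classical
  refine ⟨?_, fun a b => ?_⟩
  · obtain ⟨t, τ, h0⟩ := hne
    obtain ⟨D, hD⟩ := Finset.card_ne_zero.1 h0
    exact ⟨⟨t, D, (Finset.mem_filter.1 hD).1⟩⟩
  · by_contra hab
    have hP : ∀ c d : Σ t, {D // D ∈ S.discs t}, S.Meet c d →
        (∃ hD : c.2.1 ∈ S.discs c.1, Relation.ReflTransGen S.Meet a ⟨c.1, c.2.1, hD⟩) →
        ∃ hD : d.2.1 ∈ S.discs d.1, Relation.ReflTransGen S.Meet a ⟨d.1, d.2.1, hD⟩ :=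
      fun c d hcd ⟨_, hc⟩ => ⟨d.2.2, hc.tail hcd⟩
    -- The discs in the component of `a`. They form a non-empty surface missing `b`, so its vector
    -- is strictly smaller.
    let P : (t : Fin n) → NormalDisc → Prop :=
      fun t D => ∃ hD : D ∈ S.discs t, Relation.ReflTransGen S.Meet a ⟨t, D, hD⟩
    have hlt := S.vec_filter_lt P hP b.2.2 (fun ⟨_, hb⟩ => hab hb)
    have hmem : a.2.1 ∈ (S.filter P hP).discs a.1 := Finset.mem_filter.2 ⟨a.2.2, a.2.2, .refl⟩
    have := h (S.filter P hP) (S.vec_filter_le P hP) ⟨_, _, (vec_pos _ hmem).ne'⟩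
    rw [this] at hlt
    exact lt_irrefl _ hlt

end NormalSurface

/-! ### The smallest integral multiple and the theorem. -/

/-- A non-zero integer vector has a smallest positive rational multiple that is integral. -/
theorem exists_isLeast_integral_multiple {ι : Type*} {v : ι → ℕ} (hv : ∃ i, v i ≠ 0) :
    ∃ c : ℚ, IsLeast {q : ℚ | 0 < q ∧ ∀ i, ∃ z : ℤ, (z : ℚ) = q * (v i : ℚ)} c := by
  classical
  obtain ⟨i₀, h₀⟩ := hv
  have h₀' : (0 : ℚ) < v i₀ := by exact_mod_cast Nat.pos_of_ne_zero h₀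
  -- An admissible factor makes coordinate `i₀` a positive integer `m`, so it equals `m / v i₀`, and
  -- minimising it means minimising `m`. The factor 1 shows that some `m` exists.
  have hex : ∃ m : ℕ, 0 < m ∧ ∀ i, ∃ z : ℤ, (z : ℚ) = (m / v i₀ : ℚ) * (v i : ℚ) :=
    ⟨v i₀, Nat.pos_of_ne_zero h₀, fun i => ⟨v i, by rw [div_self h₀'.ne']; simp⟩⟩
  obtain ⟨h1, h2⟩ := Nat.find_spec hex
  refine ⟨_, ⟨div_pos (Nat.cast_pos.2 h1) h₀', h2⟩, ?_⟩
  rintro q ⟨hq, hz⟩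
  obtain ⟨m, hm⟩ := hz i₀
  have hm0 : 0 < m := by
    have : (0 : ℚ) < m := hm ▸ mul_pos hq h₀'
    exact_mod_cast this
  lift m to ℕ using hm0.le
  have e : q = (m : ℚ) / v i₀ := by
    rw [eq_div_iff h₀'.ne', ← hm]
    simp
  rw [e, div_le_div_iff_of_pos_right h₀']
  exact_mod_cast Nat.find_min' hex ⟨by exact_mod_cast hm0, fun i => e ▸ hz i⟩

theorem lemma3p8 {n : ℕ} (T : Triangulation n) (hT : T.NoReversedEdge) (S : NormalSurface T)
    (hS : 0 < S.eulerChar)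
    (hmin : ¬ ∃ S' : NormalSurface T, 0 < S'.eulerChar ∧
      (∀ t τ, S.vec t τ = 0 → S'.vec t τ = 0) ∧
      ∃ t τ, S.vec t τ ≠ 0 ∧ S'.vec t τ = 0) :
    (∃ c : ℚ, IsLeast {q : ℚ | 0 < q ∧ ∀ t τ, ∃ z : ℤ, (z : ℚ) = q * (S.vec t τ : ℚ)} c ∧
      (∃ U : NormalSurface T, ∀ t τ, (U.vec t τ : ℚ) = c * (S.vec t τ : ℚ)) ∧
      ∀ U : NormalSurface T, (∀ t τ, (U.vec t τ : ℚ) = c * (S.vec t τ : ℚ)) →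
        U.Connected ∧ 0 < U.eulerChar) ∧
    ((fun t τ => (S.vec t τ : ℝ)) ≠ (0 : Fin n → DiscType → ℝ) ∧
      IsExtreme ℝ T.matchingCone
        {x | ∃ a : ℝ, 0 ≤ a ∧ x = a • fun t τ => (S.vec t τ : ℝ)}) := by
  have hM : S.MinimalSupport := ⟨hS, hmin⟩
  obtain ⟨t₀, τ₀, h₀⟩ := NormalSurface.exists_vec_ne_zero hS hT
  refine ⟨?_, fun h => h₀ (Nat.cast_eq_zero.1 (congrFun (congrFun h t₀) τ₀)), hM.isExtreme hT⟩
  obtain ⟨c, hc⟩ := exists_isLeast_integral_multiple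
    (v := fun p : Fin n × DiscType => S.vec p.1 p.2) ⟨(t₀, τ₀), h₀⟩
  simp only [Prod.forall] at hc
  have hc0 : 0 < c := hc.1.1
  refine ⟨c, hc, ?_, fun U hU => ⟨?_, ?_⟩⟩
  · have hu : ∀ t τ, ∃ u : ℕ, (u : ℚ) = c * S.vec t τ := by
      intro t τ
      obtain ⟨z, hz⟩ := hc.1.2 t τ
      have hz0 : 0 ≤ z := by
        have : (0 : ℚ) ≤ z := hz ▸ mul_nonneg hc0.le (Nat.cast_nonneg _)
        exact_mod_cast this
      lift z to ℕ using hz0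
      exact ⟨z, by exact_mod_cast hz⟩
    choose u hu using hu
    have hm : T.Matching u := by
      refine Triangulation.Matching.of_map (φ := Nat.castAddMonoidHom ℚ) Nat.cast_injective ?_
      have : (fun t τ => (u t τ : ℚ)) = c • fun t τ => (S.vec t τ : ℚ) := by
        funext t τ
        exact hu t τ
      exact (congrArg T.Matching this).mpr (S.matching_vec_rat.smul c)
    obtain ⟨U, hU⟩ := hm.exists_surface (S.admissible_of_support fun t τ h => by
      have := hu t τ
      rw [h, Nat.cast_zero, mul_zero] at this
      exact_mod_cast this)
    exact ⟨U, fun t τ => by rw [hU, hu]⟩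
  · have hzero : ∀ t τ, S.vec t τ = 0 → U.vec t τ = 0 := by
      intro t τ h
      have := hU t τ
      rw [h, Nat.cast_zero, mul_zero] at this
      exact_mod_cast this
    refine U.connected_of_forall_vec ⟨t₀, τ₀, fun h => ?_⟩ fun U' hle ⟨t₁, τ₁, h₁⟩ => ?_
    · have := hU t₀ τ₀
      rw [h, Nat.cast_zero, eq_comm, mul_eq_zero] at this
      exact this.elim hc0.ne' fun h => h₀ (by exact_mod_cast h)
    · obtain ⟨q, hq⟩ := hM.exists_eq_mul hT U'.matching_vec_rat fun t τ h => by
        exact_mod_cast Nat.le_zero.1 ((hle t τ).trans (hzero t τ h).le)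
      have hq0 : 0 < q := by
        have : (0 : ℚ) < U'.vec t₁ τ₁ := by exact_mod_cast Nat.pos_of_ne_zero h₁
        rw [hq] at this
        exact pos_of_mul_pos_left this (Nat.cast_nonneg _)
      -- The vector of `U'` is itself an integral positive multiple, so leastness of `c` makes it at
      -- least that of `U`.
      have hcq : c ≤ q := hc.2 ⟨hq0, fun t τ => ⟨U'.vec t τ, by rw [← hq]; simp⟩⟩
      funext t τ
      refine le_antisymm (hle t τ) ?_
      have : (U.vec t τ : ℚ) ≤ U'.vec t τ := by
        rw [hU, hq]
        exact mul_le_mul_of_nonneg_right hcq (Nat.cast_nonneg _)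
      exact_mod_cast this
  · have h1 := U.eulerChar_eq hT
    have h2 : (fun t τ => (U.vec t τ : ℚ)) = c • fun t τ => (S.vec t τ : ℚ) := by
      funext t τ
      exact hU t τ
    rw [h2, map_smul, ← S.eulerChar_eq hT, smul_eq_mul] at h1
    have : (0 : ℚ) < U.eulerChar := h1 ▸ mul_pos hc0 (by exact_mod_cast hS)
    exact_mod_cast this
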